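/- **Setting.** Let $P$ be a probability distribution of $Z\in\mathcal Z$, let $\mathcal F$ be a measurable space, and let $\ell_f(z)\in(-\infty,\infty]$ be a jointly measurable loss such that $\mathbf E[\ell_f^-]<\infty$ for all $f\in\mathcal F$ and $\mathbf E[\ell_f]<\infty$ for some $f$; $Z_1,Z_2,\dots$ are i.i.d. $\sim P$. Fix a comparator $f^*\in\mathcal F$ and put $L_f:=\ell_f-\ell_{f^*}$. Expectations are taken in $[-\infty,\infty]$. A distribution $Q$ on $\mathcal F$ is a probability measure with $\mathbf E_{f\sim Q}[\ell_f(z)^-]<\infty$ for all $z$. For a prior $\Pi_0$ on $\mathcal F$ and an algorithm that outputs a distribution $\Pi_n=\Pi_n(Z_1,\dots,Z_n)$ on $\mathcal F$, the information complexity is $$\mathrm{IC}_{n,\eta}:=\mathbf E_{f\sim\Pi_n}\Big[\frac1n\sum_{i=1}^nL_f(Z_i)\Big]+\frac{\mathrm{KL}(\Pi_n\|\Pi_0)}{\eta n}.$$ A deterministic estimator $\hat f=\hat f(Z_1,\dots,Z_n)$ is identified with the point mass $\Pi_n=\delta_{\hat f}$. Let $v:[0,\infty)\to[0,\infty)$ be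 bounded and nondecreasing with $v(\epsilon)>0$ for $\epsilon>0$. * *$v$-central*: for all $\epsilon\ge0$ and $f\in\mathcal F$, with $\eta=v(\epsilon)>0$, $\mathbf E[e^{\eta(\ell_{f^*}-\ell_f-\epsilon)}]\le1$. * *$v$-PPC*: for all $\epsilon\ge0$ with $\eta=v(\epsilon)>0$, $\ \mathbf E[\ell_{f^*}]-\inf_Q\mathbf E_{Z\sim P}\big[-\frac1\eta\log\mathbf E_{f\sim Q}[e^{-\eta\ell_f(Z)}]\big]\le\epsilon$, the infimum being over distributions $Q$ on $\mathcal F$. **Theorem (excess risk bound, unbounded excess risk case).** Let $u\ge1$, $c\in(0,1]$, $\tau(x)=u\max(1,x)$, and assume the $(\tau,c)$-witness condition: every $f\in\mathcal F$ has finite excess risk $\mathbf E[L_f]$, and $\mathbf E\big[L_f\mathbf 1\{L_f\le\tau(\mathbf E[L_f])\}\big]\ge c\,\mathbf E[L_f]$. Let $\eta_n$ and $\epsilon_n\ge0$ be sequences with $n\eta_n\to\infty$, $\epsilon_n\to0$ and $0<\eta_n<v(\epsilon_n)/2$ for all $n\ge1$, and let $$c_2'=c'_{2,n}:=\frac uc\cdot\frac{2\eta_n+1}{1-2\eta_n/v(\epsilon_n)}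 .$$ Consider algorithms with $\mathbf E[\mathrm{IC}_{n,\eta_n}]\to0$. 1. *Deterministic estimators $(\hat f,\Pi_0)$.* (a) Suppose $v$-PPC holds. For all $n\ge1$ and $\delta>0$ such that the right-hand side below is at most $1$, with probability at least $1-\delta$, $$\mathbf E[L_{\hat f}]\le c_2'\cdot\frac1\delta\cdot\big(\mathbf E[\mathrm{IC}_{n,\eta_n}]+\epsilon_n\big)$$ (on the left, the expectation is over a fresh $Z$ with $\hat f$ fixed). If for some $\kappa<1/2$ we have $\eta_n\le\kappa v(\epsilon_n)$ for all large $n$, then for every $\delta>0$ the right-hand side is at most $1$ for all $n\ge n_0(\delta)$. (b) Suppose $v$-central holds. Let $\overline{\mathrm{IC}}_{n}\ge\mathrm{IC}_{n,\eta_n}$ a.s. with $\mathbf E[\overline{\mathrm{IC}}_n]\to0$, and let $C_{n,\delta}$ $(n\ge1,\ 0<\delta<1)$ satisfy $C_{n,\delta}>2\log(2/\delta)$ and $P\big(\overline{\mathrm{IC}}_n\ge C_{n,\delta}\mathbf E[\overline{\mathrm{IC}}_n]\big)\le\delta/2$. For all $n\ge1$ and $0<\delta<1$ such that the right-hand side below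 is at most $1$, with probability at least $1-\delta$, $$\mathbf E[L_{\hat f}]\le c_2'\cdot C_{n,\delta}\cdot\Big(\mathbf E[\overline{\mathrm{IC}}_n]+\epsilon_n+\frac1{n\eta_n}\Big).$$ If for some $\kappa<1/2$ we have $\eta_n\le\kappa v(\epsilon_n)$ for all large $n$, then for every $\delta\in(0,1)$ for which $n\mapsto C_{n,\delta}$ is bounded above, the right-hand side is at most $1$ for all $n\ge n_0(\delta)$. 2. *General, possibly randomized, algorithms.* Suppose $v$-PPC holds and $c_2'(\mathbf E[\mathrm{IC}_{n,\eta_n}]+\epsilon_n)\to0$ (automatic if $\limsup_n\eta_n/v(\epsilon_n)<1/2$). Let $a_n\to\infty$ and let $\overline{\mathrm{IC}}_n\ge a_n\mathrm{IC}_{n,\eta_n}$ a.s. Then $$\Pi_n\big(\{f\in\mathcal F:\mathbf E[L_f]>c_2'\cdot(\mathbf E[\overline{\mathrm{IC}}_n]+a_n\epsilon_n)\}\big)\to0\quad\text{in }P\text{-probability}.$$ If moreover $\epsilon_n$ is negligible relative to $\mathbf E[\overline{\mathrm{IC}}_n]$ (for every $M$, $M\epsilon_n\le\mathbf E[\overline{\mathrm{IC}}_n]$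 for all large $n$), then the same holds with $c_2'\cdot(\mathbf E[\overline{\mathrm{IC}}_n]+\epsilon_n)$ in place of $c_2'\cdot(\mathbf E[\overline{\mathrm{IC}}_n]+a_n\epsilon_n)$. -/

import Mathlib

open MeasureTheory ProbabilityTheory Filter Topology
open scoped ENNReal NNReal

noncomputable section

/-- Expectation of an extended random variable: expectation of the positive part minus expectation
of the negative part. -/
def extExp {Ω : Type*} [MeasurableSpace Ω] (μ : Measure Ω) (X : Ω → EReal) : EReal :=
  ((∫⁻ ω, (X ω).toENNReal ∂μ : ℝ≥0∞) : EReal) - ((∫⁻ ω, (-(X ω)).toENNReal ∂μ : ℝ≥0∞) : EReal)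

/-- Exponential stochastic inequality: `E[exp (η (U - U'))] ≤ 1`. -/
def ESI {Ω : Type*} [MeasurableSpace Ω] (μ : Measure Ω) (η : ℝ) (U U' : Ω → EReal) : Prop :=
  ∫⁻ ω, EReal.exp ((η : EReal) * (U ω - U' ω)) ∂μ ≤ 1

section Learning

variable {Z F : Type*} [MeasurableSpace Z] [MeasurableSpace F]

/-- A learning problem `(P, loss, F)`. Losses take values in `(-∞, ∞]`, every `loss f` has a
`P`-integrable negative part, and some `f` has finite risk. -/
structure IsLearningProblem (P : Measure Z) (loss : F → Z → EReal) : Prop where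
  measurable : Measurable (fun p : F × Z => loss p.1 p.2)
  ne_bot : ∀ f z, loss f z ≠ ⊥
  neg_part : ∀ f, ∫⁻ z, (-(loss f z)).toENNReal ∂P < ∞
  nontrivial : ∃ f, extExp P (loss f) < ⊤

/-- `Q` is a distribution on `F`: a probability measure for which the negative part of
`f ↦ loss f z` is `Q`-integrable for every outcome `z`. -/
def IsDistributionOn (loss : F → Z → EReal) (Q : Measure F) : Prop :=
  IsProbabilityMeasure Q ∧ ∀ z, ∫⁻ f, (-(loss f z)).toENNReal ∂Q < ∞

/-- The excess loss `L_f = loss f - loss fstar`. -/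
def excessLoss (loss : F → Z → EReal) (fstar f : F) (z : Z) : EReal :=
  loss f z - loss fstar z

/-- The excess risk `E[L_f]`. -/
def excessRisk (P : Measure Z) (loss : F → Z → EReal) (fstar f : F) : EReal :=
  extExp P (excessLoss loss fstar f)

open Classical in
/-- The `(τ, c)`-witness condition. As `τ` is a function of finite nonnegative reals, it presupposes
that each excess risk is a (finite) real number `r`. -/
def TauWitness (P : Measure Z) (loss : F → Z → EReal) (fstar : F) (τ : ℝ → ℝ) (c : ℝ) : Prop :=
  ∀ f, ∃ r : ℝ, excessRisk P loss fstar f = (r : EReal) ∧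
    ((c * r : ℝ) : EReal) ≤
      extExp P (fun z => if excessLoss loss fstar f z ≤ ((τ r : ℝ) : EReal)
        then excessLoss loss fstar f z else 0)

/-- The functions `v` used in the `v`-central and `v`-PPC conditions: bounded, nondecreasing, and
positive at positive arguments. -/
structure IsEasinessFunction (v : ℝ≥0 → ℝ≥0) : Prop where
  mono : Monotone v
  bdd : BddAbove (Set.range v)
  pos : ∀ ε, 0 < ε → 0 < v ε

/-- The `v`-central condition with comparator `fstar`: `loss fstar - loss f ⊴_{v ε} ε` for all
`ε ≥ 0` and all `f`. -/
def VCentral (P : Measure Z) (loss : F → Z → EReal) (fstar : F) (v : ℝ≥0 → ℝ≥0) : Prop :=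
  ∀ ε : ℝ≥0, 0 < v ε → ∀ f,
    ESI P (v ε) (fun z => loss fstar z - loss f z) (fun _ => ((ε : ℝ) : EReal))

/-- The mix loss `-(1/η) log E_{f ∼ Q}[exp (-η loss f z)]`. -/
def mixLoss (loss : F → Z → EReal) (η : ℝ) (Q : Measure F) (z : Z) : EReal :=
  ((-η⁻¹ : ℝ) : EReal) * ENNReal.log (∫⁻ f, EReal.exp (((-η : ℝ) : EReal) * loss f z) ∂Q)

/-- The `v`-PPC condition with comparator `fstar`: for all `ε ≥ 0`, with `η = v ε`, the risk of
`fstar` exceeds the infimum over distributions `Q` on `F` of the expected mix loss by at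
most `ε`. -/
def VPPC (P : Measure Z) (loss : F → Z → EReal) (fstar : F) (v : ℝ≥0 → ℝ≥0) : Prop :=
  ∀ ε : ℝ≥0, 0 < v ε →
    extExp P (loss fstar) -
      (⨅ (Q : Measure F) (_ : IsDistributionOn loss Q), extExp P (mixLoss loss (v ε) Q))
        ≤ ((ε : ℝ) : EReal)

/-- The law of an i.i.d. sample `Z_1, …, Z_n` from `P`. -/
def sampleLaw (P : Measure Z) (n : ℕ) : Measure (Fin n → Z) := Measure.pi (fun _ => P)

/-- The information complexity, at the sample `z` of size `n`, of a learning algorithm that has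
prior `prior` and outputs the distribution `post n z`:
`E_{f ∼ post n z}[(1/n) ∑ L_f(z_i)] + KL(post n z ‖ prior) / (η n)`. -/
def infoComplexity (loss : F → Z → EReal) (fstar : F) (prior : Measure F)
    (post : (n : ℕ) → (Fin n → Z) → Measure F) (η : ℝ) (n : ℕ) (z : Fin n → Z) : EReal :=
  extExp (post n z)
      (fun f => (((n : ℝ)⁻¹ : ℝ) : EReal) * ∑ i, excessLoss loss fstar f (z i))
    + ((InformationTheory.klDiv (post n z) prior : ℝ≥0∞) : EReal) / ((η * n : ℝ) : EReal)

/-- The output of a deterministic estimator, seen as a point mass. -/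
def pointPost (fhat : (n : ℕ) → (Fin n → Z) → F) (n : ℕ) (z : Fin n → Z) : Measure F :=
  Measure.dirac (fhat n z)

/-- The factor `c'₂ = (u / c) (2 η + 1) / (1 - 2 η / w)`, where `w` stands for `v ε`. -/
def factorC₂ (u c η w : ℝ) : ℝ := u / c * ((2 * η + 1) / (1 - 2 * η / w))

end Learning

end

/-!
The excess risk `r` of a predictor `f` is controlled through the generalized Hellinger divergence
`h f = (1 - E[exp (-η (L_f + Y))]) / η` from a *pseudo-comparator*, a function `loss fstar - Y` of the
outcome with `E[Y] ≤ ε` and `E[exp (-θ (L_f + Y))] ≤ 1` for all `f`, where `θ = v ε > 2 η`.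

* Under the `v`-central condition `Y = ε` is such a function (`VCentral.isPseudoComparator`). Under
  the `v`-PPC condition it comes from the generalized reverse information projection: a minimizing
  sequence of mix losses is Cauchy in `L¹` by the strict convexity of `-log`, and the first-order
  conditions at the minimum give the exponential moment bounds
  (`IsMixtureClass.exists_projection`, `VPPC.exists_isPseudoComparator`).
* With `s_η x = (1 - exp (-η x)) / η` and `A = (1 + 2 η u) / (1 - 2 η / θ)`, the pointwise inequality
  `x 1{x ≤ u} + s_θ y ≤ A s_η (x + y) - (A - 1) s_θ (x + y)` (`truncated_add_hellUtil_le`) and the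
  witness condition give `min r 1 ≤ factorC₂ u c η θ * h f`
  (`IsPseudoComparator.min_excessRisk_le`). A bound below `1` on the right thus bounds `r` itself.
* The Gibbs variational inequality, in the linear form `E_Q[φ] + 1 ≤ KL(Q ‖ ν) + E_ν[exp φ]`, bounds
  the posterior mean of `h` by the information complexity (`le_infoComplexity`): in expectation by
  `E[IC] + ε`, and for constant `Y` also with exponential tails.

Markov's inequality or the tail bound then yields the statements for deterministic estimators. For a
randomized algorithm, Markov's inequality is applied to the law of the random predictor averaged over
the sample.
-/

/-! ### Exponential utilities -/

/-- The exponential utility `(1 - exp (-η x)) / η` at rate `η`: a concave minorant of `x`,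
decreasing in `η`, whose expectation is a generalized Hellinger divergence. -/
noncomputable def hellUtil (η x : ℝ) : ℝ := (1 - Real.exp (-(η * x))) / η

lemma hellUtil_le_self {η : ℝ} (hη : 0 < η) (x : ℝ) : hellUtil η x ≤ x := by
  unfold hellUtil
  rw [div_le_iff₀ hη]
  have := Real.add_one_le_exp (-(η * x))
  nlinarith

lemma hellUtil_zero (η : ℝ) : hellUtil η 0 = 0 := by simp [hellUtil]

lemma hellUtil_anti {η θ : ℝ} (hη : 0 < η) (h : η ≤ θ) (x : ℝ) : hellUtil θ x ≤ hellUtil η x := by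
  have hθ : 0 < θ := hη.trans_le h
  have hw : 0 ≤ 1 - η / θ := by
    have := (div_le_one hθ).2 h
    linarith
  have key := convexOn_exp.2 (Set.mem_univ (-(θ * x))) (Set.mem_univ 0)
    (div_nonneg hη.le hθ.le) hw (by ring)
  have e : η / θ * -(θ * x) = -(η * x) := by field_simp
  simp only [smul_eq_mul, mul_zero, add_zero, Real.exp_zero, mul_one, e] at key
  unfold hellUtil
  rw [div_le_div_iff₀ hθ hη]
  have : θ * Real.exp (-(η * x)) ≤ η * Real.exp (-(θ * x)) + θ - η := by
    calc _ ≤ θ * _ := mul_le_mul_of_nonneg_left key hθ.le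
      _ = _ := by field_simp; ring
  nlinarith

lemma hellUtil_le_inv {η : ℝ} (hη : 0 < η) (x : ℝ) : hellUtil η x ≤ 1 / η := by
  unfold hellUtil
  gcongr
  linarith [Real.exp_pos (-(η * x))]

lemma hellUtil_mono {η : ℝ} (hη : 0 < η) : Monotone (hellUtil η) := by
  intro x y h
  unfold hellUtil
  gcongr

lemma hellUtil_add (η x y : ℝ) :
    hellUtil η (x + y) = hellUtil η x + Real.exp (-(η * x)) * hellUtil η y := by
  unfold hellUtil
  rw [show -(η * (x + y)) = -(η * x) + -(η * y) by ring, Real.exp_add]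
  ring

lemma hellUtil_nonneg {η x : ℝ} (hη : 0 < η) (hx : 0 ≤ x) : 0 ≤ hellUtil η x := by
  simpa [hellUtil_zero] using hellUtil_mono hη hx

/-- The combination `A s₁ - (A - 1) s_k` of the utilities at rates `1` and `k`. -/
noncomputable def hellComb (A k x : ℝ) : ℝ := A * hellUtil 1 x - (A - 1) * hellUtil k x

lemma exp_le_one_add_two_mul {x : ℝ} (h0 : 0 ≤ x) (h1 : x ≤ 1) : Real.exp x ≤ 1 + 2 * x := by
  have key := convexOn_exp.2 (Set.mem_univ (1 : ℝ)) (Set.mem_univ 0) h0 (sub_nonneg.2 h1) (by ring)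
  simp only [smul_eq_mul, mul_zero, add_zero, Real.exp_zero, mul_one] at key
  nlinarith [Real.exp_one_lt_d9]

/-- The derivative of `hellComb` is at least `1` on `[0, min a 1]`. -/
lemma hellComb_slope_ge_one {k a x : ℝ} (hk : 2 < k) (hx : 0 ≤ x) (hxa : x ≤ a) (hx1 : x ≤ 1) :
    1 ≤ (1 + 2 * a) / (1 - 2 / k) * Real.exp (-x)
      - ((1 + 2 * a) / (1 - 2 / k) - 1) * Real.exp (-(k * x)) := by
  set A := (1 + 2 * a) / (1 - 2 / k) with hA
  have hk0 : 0 < k := by linarith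
  have hA' : A = k * (1 + 2 * a) / (k - 2) := by
    rw [hA]; have : k - 2 ≠ 0 := by linarith
    field_simp
  have hAx : k * (1 + 2 * x) / (k - 2) ≤ A := by
    rw [hA']; have : 0 < k - 2 := by linarith
    gcongr
  -- Multiplied by `exp (k x)`, the claim reads `exp (k x) - 1 ≤ A * (exp ((k - 1) x) - 1)`.
  set w := Real.exp ((k - 1) * x) with hw
  have hw1 : 1 + (k - 1) * x ≤ w := by rw [hw]; linarith [Real.add_one_le_exp ((k - 1) * x)]
  have hex := exp_le_one_add_two_mul hx hx1
  have hkx : Real.exp (k * x) = Real.exp x * w := by rw [hw, ← Real.exp_add]; ring_nf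
  have hw2 : 1 ≤ w := by nlinarith
  have main : Real.exp (k * x) - 1 ≤ A * (w - 1) := by
    have h1 : Real.exp (k * x) - 1 ≤ (1 + 2 * x) * w - 1 := by
      rw [hkx]; nlinarith
    have h2 : (1 + 2 * x) * w - 1 ≤ k * (1 + 2 * x) / (k - 2) * (w - 1) := by
      have : 0 < k - 2 := by linarith
      rw [div_mul_eq_mul_div, le_div_iff₀ this]
      nlinarith [mul_le_mul_of_nonneg_left hw1 (by linarith : 0 ≤ 2 * (1 + 2 * x)),
        mul_nonneg (by linarith : 0 ≤ k - 1) (mul_nonneg hx hx)]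
    nlinarith [mul_le_mul_of_nonneg_right hAx (by linarith : 0 ≤ w - 1)]
  have e1 : Real.exp (-x) = w * Real.exp (-(k * x)) := by
    rw [hw, ← Real.exp_add]; ring_nf
  have e2 : Real.exp (k * x) * Real.exp (-(k * x)) = 1 := by rw [← Real.exp_add]; simp
  rw [e1]
  nlinarith [Real.exp_pos (-(k * x))]

lemma hasDerivAt_hellUtil {η : ℝ} (hη : η ≠ 0) (x : ℝ) :
    HasDerivAt (hellUtil η) (Real.exp (-(η * x))) x := by
  unfold hellUtil
  have h : HasDerivAt (fun x : ℝ => (1 - Real.exp (-(η * x))) / η)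
      ((0 - Real.exp (-(η * x)) * (-(η * 1))) / η) x :=
    (((hasDerivAt_const x (1:ℝ)).sub (((hasDerivAt_id x).const_mul η).neg.exp)).div_const η)
  convert h using 1
  field_simp
  ring

lemma hasDerivAt_hellComb_sub {A k : ℝ} (hk : k ≠ 0) (x : ℝ) :
    HasDerivAt (fun x => hellComb A k x - x)
      (A * Real.exp (-x) - (A - 1) * Real.exp (-(k * x)) - 1) x := by
  have h1 := hasDerivAt_hellUtil one_ne_zero x
  simp only [one_mul] at h1
  exact ((h1.const_mul A).sub ((hasDerivAt_hellUtil hk x).const_mul (A - 1))).sub (hasDerivAt_id x)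

lemma hellComb_zero (A k : ℝ) : hellComb A k 0 = 0 := by simp [hellComb, hellUtil_zero]

/-- `hellComb A k x - x` vanishes at `0`, is antitone on `(-∞, 0]` and monotone on `[0, min a 1]`. -/
lemma self_le_hellComb {k a x : ℝ} (hk : 2 < k) (ha : 0 ≤ a) (hxa : x ≤ a) (hx1 : x ≤ 1) :
    x ≤ hellComb ((1 + 2 * a) / (1 - 2 / k)) k x := by
  set A := (1 + 2 * a) / (1 - 2 / k) with hA
  have hk0 : k ≠ 0 := by linarith
  have hd := fun y => hasDerivAt_hellComb_sub (A := A) hk0 y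
  have hc : Continuous (fun x => hellComb A k x - x) :=
    continuous_iff_continuousAt.2 fun y => (hd y).continuousAt
  suffices h : hellComb A k 0 - 0 ≤ hellComb A k x - x by rw [hellComb_zero] at h; linarith
  rcases le_total 0 x with hx | hx
  · refine monotoneOn_of_deriv_nonneg (convex_Icc 0 x) hc.continuousOn
      (fun y _ => (hd y).differentiableAt.differentiableWithinAt) ?_
      (Set.left_mem_Icc.2 hx) (Set.right_mem_Icc.2 hx) hx
    intro y hy
    rw [interior_Icc] at hy
    rw [(hd y).deriv]
    have := hellComb_slope_ge_one (a := a) hk hy.1.le (hy.2.le.trans hxa) (hy.2.le.trans hx1)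
    linarith
  · refine antitoneOn_of_deriv_nonpos (convex_Icc x 0) hc.continuousOn
      (fun y _ => (hd y).differentiableAt.differentiableWithinAt) ?_
      (Set.left_mem_Icc.2 hx) (Set.right_mem_Icc.2 hx) hx
    intro y hy
    rw [interior_Icc] at hy
    rw [(hd y).deriv]
    have hA1 : k / (k - 1) ≤ A := by
      have h2 : 0 < 1 - 2 / k := by rw [sub_pos, div_lt_one (by linarith)]; exact hk
      rw [hA, le_div_iff₀ h2, div_mul_eq_mul_div, div_le_iff₀ (by linarith)]
      have : k * (1 - 2 / k) = k - 2 := by field_simp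
      rw [this]
      nlinarith
    -- with `s = -y ≥ 0`, the utility at rate `k` is below the one at rate `k - 1`
    have h3 := hellUtil_anti (show 0 < k - 1 by linarith) (show k - 1 ≤ k by linarith) (-y)
    unfold hellUtil at h3
    have e3 : -(k * -y) = k * y := by ring
    have e4 : -((k - 1) * -y) = (k - 1) * y := by ring
    rw [e3, e4, div_le_div_iff₀ (by linarith) (by linarith)] at h3
    have h5 : Real.exp ((k - 1) * y) ≤ 1 := Real.exp_le_one_iff.2 (by nlinarith [hy.2])
    have h4 : 1 - Real.exp (k * y) ≤ A * (1 - Real.exp ((k - 1) * y)) := by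
      calc _ ≤ k / (k - 1) * (1 - Real.exp ((k - 1) * y)) := by
            rw [div_mul_eq_mul_div, le_div_iff₀ (by linarith)]; linarith
        _ ≤ _ := by gcongr
    have e1 : Real.exp (-y) = Real.exp ((k - 1) * y) * Real.exp (-(k * y)) := by
      rw [← Real.exp_add]; ring_nf
    have e2 : Real.exp (k * y) * Real.exp (-(k * y)) = 1 := by rw [← Real.exp_add]; simp
    rw [e1]
    nlinarith [Real.exp_pos (-(k * y))]

lemma hellComb_mono {A k x y : ℝ} (hA : 1 ≤ A) (hk : 1 ≤ k) (hx : 0 ≤ x) (hxy : x ≤ y) :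
    hellComb A k x ≤ hellComb A k y := by
  have hd : 0 ≤ y - x := by linarith
  have e : y = x + (y - x) := by ring
  rw [e]
  unfold hellComb
  rw [hellUtil_add, hellUtil_add k]
  have h1 : Real.exp (-(k * x)) * hellUtil k (y - x) ≤ Real.exp (-(1 * x)) * hellUtil 1 (y - x) := by
    gcongr
    · exact hellUtil_nonneg (by linarith) hd
    · exact hellUtil_anti one_pos hk _
  have h2 := mul_nonneg (Real.exp_pos (-(k * x))).le (hellUtil_nonneg (by linarith : 0 < k) hd)
  nlinarith

lemma hellComb_truncated_ineq_of_le {k a x : ℝ} (hk : 2 < k) (ha : 0 ≤ a) (hxa : x ≤ a) (y : ℝ) :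
    x + hellUtil k y ≤ hellComb ((1 + 2 * a) / (1 - 2 / k)) k (x + y) := by
  have hk0 : 0 < k := by linarith
  have hS := hellUtil_le_self hk0 y
  have hq : 0 < 1 - 2 / k := by rw [sub_pos, div_lt_one (by linarith)]; exact hk
  have hA1 : 1 ≤ (1 + 2 * a) / (1 - 2 / k) := by
    rw [le_div_iff₀ hq]
    have : 0 < 2 / k := by positivity
    nlinarith
  by_cases h : x + y ≤ a ∧ x + y ≤ 1
  · exact (by linarith : x + hellUtil k y ≤ x + y).trans (self_le_hellComb hk ha h.1 h.2)
  -- For `a ≥ 1` and `x + y ≥ 1` the right-hand side already exceeds `a + 1 / k`.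
  rcases le_total 1 a with ha1 | ha1
  · have h1 : 1 ≤ x + y := by by_contra h1; exact h ⟨by linarith, by linarith⟩
    set p := Real.exp (-(1 * (x + y))) with hp
    have hp1 : p < 0.37 := by
      have h3 : p ≤ Real.exp (-1) := by rw [hp]; gcongr; linarith
      have := Real.exp_neg_one_lt_d9
      norm_num at this ⊢; linarith
    have h2 : hellUtil k y ≤ 1 / k := hellUtil_le_inv hk0 y
    have h3 : hellUtil k (x + y) ≤ 1 / k := hellUtil_le_inv hk0 _
    set κ := 1 / k with hκ
    have hκ0 : 0 < κ := by positivity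
    have e2 : 2 / k = 2 * κ := by rw [hκ]; ring
    rw [e2] at hq hA1 ⊢
    set A := (1 + 2 * a) / (1 - 2 * κ) with hA
    have hAe : A * (1 - 2 * κ) = 1 + 2 * a := by rw [hA]; field_simp
    have h4 : A * (1 - p - κ) ≤ hellComb A k (x + y) := by
      have e : hellUtil 1 (x + y) = 1 - p := by simp [hellUtil, hp]
      unfold hellComb
      rw [e]
      nlinarith
    have h5 : (1 + 2 * a) * 0.63 ≤ A * (1 - p - κ) := by
      rw [← hAe]; nlinarith
    nlinarith
  -- For `a < 1` the sum `x + y` exceeds `a`, and for a fixed sum `x = a` is the worst case.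
  · have h1 : a < x + y := by by_contra h1; exact h ⟨by linarith, by linarith⟩
    set d := x + y - a with hd
    have hd0 : 0 < d := by linarith
    have h2 : hellUtil k y ≤ hellUtil k d + (y - d) := by
      have e : y = d + (y - d) := by ring
      have h3 : 0 ≤ y - d := by linarith
      rw [e, hellUtil_add, ← e]
      have h4 : Real.exp (-(k * d)) ≤ 1 := Real.exp_le_one_iff.2 (by nlinarith)
      nlinarith [hellUtil_le_self hk0 (y - d), hellUtil_nonneg hk0 h3]
    have h3 := self_le_hellComb hk ha le_rfl ha1
    have h4 := hellComb_slope_ge_one hk ha le_rfl ha1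
    set A := (1 + 2 * a) / (1 - 2 / k) with hA
    have h5 : a + hellUtil k d ≤ hellComb A k (a + d) := by
      unfold hellComb at h3 ⊢
      rw [hellUtil_add, hellUtil_add k, one_mul]
      have h6 := hellUtil_anti one_pos (by linarith : 1 ≤ k) d
      have h7 := hellUtil_nonneg hk0 hd0.le
      nlinarith [mul_le_mul_of_nonneg_left h6 (mul_nonneg (by linarith : 0 ≤ A) (Real.exp_pos (-a)).le),
        mul_le_mul_of_nonneg_right h4 h7]
    have e : x + y = a + d := by ring
    rw [e]
    linarith

lemma hellComb_truncated_ineq {k a : ℝ} (hk : 2 < k) (ha : 0 ≤ a) (x y : ℝ) :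
    (if x ≤ a then x else 0) + hellUtil k y ≤ hellComb ((1 + 2 * a) / (1 - 2 / k)) k (x + y) := by
  split_ifs with h
  · exact hellComb_truncated_ineq_of_le hk ha h y
  push Not at h
  have hk0 : 0 < k := by linarith
  have hq : 0 < 1 - 2 / k := by rw [sub_pos, div_lt_one (by linarith)]; exact hk
  have hA1 : 1 ≤ (1 + 2 * a) / (1 - 2 / k) := by
    rw [le_div_iff₀ hq]
    have : 0 < 2 / k := by positivity
    nlinarith
  have h0 := hellComb_truncated_ineq_of_le hk ha ha
  rcases le_total 0 y with hy | hy
  · exact (h0 y).trans (hellComb_mono hA1 (by linarith) (by linarith) (by linarith))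
  have h2 := hellUtil_le_self hk0 y
  rcases le_total 0 (x + y) with hxy | hxy
  · have := hellComb_mono (k := k) hA1 (by linarith) le_rfl hxy
    rw [hellComb_zero] at this
    linarith
  · have := self_le_hellComb (x := x + y) hk ha (by linarith) (by linarith)
    linarith

/-- The pointwise inequality behind the witness bound. Here `x` is the excess loss and `y` the gap
between the comparator and a pseudo-comparator, so that `x + y` is the excess loss over the latter;
the term `hellUtil θ y` makes up for measuring the truncation `x ≤ u` against the comparator. -/
lemma truncated_add_hellUtil_le {η θ u : ℝ} (hη : 0 < η) (hθ : 2 * η < θ) (hu : 0 ≤ u) (x y : ℝ) :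
    (if x ≤ u then x else 0) + hellUtil θ y ≤
      (1 + 2 * (η * u)) / (1 - 2 * η / θ) * hellUtil η (x + y)
        - ((1 + 2 * (η * u)) / (1 - 2 * η / θ) - 1) * hellUtil θ (x + y) := by
  have hθ0 : 0 < θ := by linarith
  have key := hellComb_truncated_ineq (k := θ / η) (a := η * u)
    (by rw [lt_div_iff₀ hη]; exact hθ) (by positivity) (η * x) (η * y)
  have e1 : ∀ t, hellUtil (θ / η) (η * t) = η * hellUtil θ t := by
    intro t
    unfold hellUtil
    rw [show θ / η * (η * t) = θ * t by field_simp]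
    field_simp
  have e2 : ∀ t, hellUtil 1 (η * t) = η * hellUtil η t := by
    intro t
    unfold hellUtil
    field_simp
  have e3 : 2 / (θ / η) = 2 * η / θ := by field_simp
  have e4 : (if η * x ≤ η * u then η * x else 0) = η * (if x ≤ u then x else 0) := by
    simp only [mul_le_mul_iff_right₀ hη, mul_ite, mul_zero]
  unfold hellComb at key
  rw [← mul_add, e1, e1, e2, e3, e4] at key
  refine le_of_mul_le_mul_left ?_ hη
  linarith

/-! ### Extended expectations -/

section ExtExp

variable {Ω : Type*} [MeasurableSpace Ω] {μ : Measure Ω} {X Y : Ω → EReal}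

lemma extExp_mono_ae (h : ∀ᵐ ω ∂μ, X ω ≤ Y ω) : extExp μ X ≤ extExp μ Y := by
  unfold extExp
  refine EReal.sub_le_sub ?_ ?_
  · exact EReal.coe_ennreal_le_coe_ennreal_iff.2
      (lintegral_mono_ae (h.mono fun ω hω => EReal.toENNReal_le_toENNReal hω))
  · exact EReal.coe_ennreal_le_coe_ennreal_iff.2
      (lintegral_mono_ae (h.mono fun ω hω =>
        EReal.toENNReal_le_toENNReal (EReal.neg_le_neg_iff.2 hω)))

lemma extExp_congr_ae (h : X =ᵐ[μ] Y) : extExp μ X = extExp μ Y :=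
  le_antisymm (extExp_mono_ae h.le) (extExp_mono_ae h.symm.le)

lemma extExp_coe {x : Ω → ℝ} (hx : Integrable x μ) :
    extExp μ (fun ω => (x ω : EReal)) = ((∫ ω, x ω ∂μ : ℝ) : EReal) := by
  have h1 : ∫⁻ ω, ENNReal.ofReal (x ω) ∂μ ≠ ∞ := hx.lintegral_lt_top.ne
  have h2 : ∫⁻ ω, ENNReal.ofReal (-(x ω)) ∂μ ≠ ∞ := hx.neg.lintegral_lt_top.ne
  rw [integral_eq_lintegral_pos_part_sub_lintegral_neg_part hx]
  unfold extExp
  simp only [← EReal.coe_neg, EReal.toENNReal_of_ne_top (EReal.coe_ne_top _), EReal.toReal_coe]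
  rw [EReal.coe_sub, EReal.coe_ennreal_toReal h1, EReal.coe_ennreal_toReal h2]

lemma extExp_eq_integral {x : Ω → ℝ} (hx : Integrable x μ) (h : ∀ᵐ ω ∂μ, X ω = (x ω : EReal)) :
    extExp μ X = ((∫ ω, x ω ∂μ : ℝ) : EReal) := by
  rw [extExp_congr_ae h, extExp_coe hx]

lemma integral_le_extExp {x : Ω → ℝ} (hx : Integrable x μ) (h : ∀ᵐ ω ∂μ, (x ω : EReal) ≤ X ω) :
    ((∫ ω, x ω ∂μ : ℝ) : EReal) ≤ extExp μ X := by
  rw [← extExp_coe hx]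
  exact extExp_mono_ae h

lemma extExp_const_mul {a : ℝ} (ha : 0 < a) (X : Ω → EReal) :
    extExp μ (fun ω => (a : EReal) * X ω) = (a : EReal) * extExp μ X := by
  have ha' : (0 : EReal) ≤ a := by exact_mod_cast ha.le
  have e : (a : EReal).toENNReal = ENNReal.ofReal a := by
    simp
  unfold extExp
  simp only [← mul_neg, EReal.toENNReal_mul ha', e]
  rw [lintegral_const_mul' _ _ ENNReal.ofReal_ne_top, lintegral_const_mul' _ _ ENNReal.ofReal_ne_top,
    EReal.coe_ennreal_mul, EReal.coe_ennreal_mul, EReal.coe_ennreal_ofReal, max_eq_left ha.le,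
    ← EReal.mul_sub_of_nonneg_of_ne_top ha' (EReal.coe_ne_top a)]

/-- `X` has a finite extended expectation only if it is a.e. finite and integrable. -/
lemma integrable_of_extExp_eq_coe (hX : AEMeasurable X μ) {r : ℝ} (h : extExp μ X = r) :
    (∀ᵐ ω ∂μ, X ω = ((X ω).toReal : EReal)) ∧ Integrable (fun ω => (X ω).toReal) μ ∧
      ∫ ω, (X ω).toReal ∂μ = r := by
  have hp : ∫⁻ ω, (X ω).toENNReal ∂μ ≠ ∞ := by
    intro hp
    unfold extExp at h
    rw [hp] at h
    generalize ∫⁻ ω, (-X ω).toENNReal ∂μ = t at h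
    rcases eq_or_ne t ∞ with ht | ht
    · simp [ht] at h
    · rw [← EReal.coe_ennreal_toReal ht] at h
      simp at h
  have hn : ∫⁻ ω, (-X ω).toENNReal ∂μ ≠ ∞ := by
    intro hn
    unfold extExp at h
    simp [hn] at h
  have hfin : ∀ᵐ ω ∂μ, X ω = ((X ω).toReal : EReal) := by
    filter_upwards [ae_lt_top' hX.ereal_toENNReal hp, ae_lt_top' hX.neg.ereal_toENNReal hn]
      with ω h1 h2
    refine (EReal.coe_toReal ?_ ?_).symm
    · rintro h3; simp [h3] at h1
    · rintro h3; simp [h3] at h2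
  have hint : Integrable (fun ω => (X ω).toReal) μ := by
    refine ⟨hX.ereal_toReal.aestronglyMeasurable, ?_⟩
    have : ∫⁻ ω, ‖(X ω).toReal‖ₑ ∂μ ≤ ∫⁻ ω, ((X ω).toENNReal + (-X ω).toENNReal) ∂μ := by
      refine lintegral_mono_ae (hfin.mono fun ω hω => ?_)
      rw [hω]
      simp only [← EReal.coe_neg, EReal.toENNReal_of_ne_top (EReal.coe_ne_top _), EReal.toReal_coe]
      rw [Real.enorm_eq_ofReal_abs]
      rcases le_total 0 (X ω).toReal with h0 | h0
      · rw [abs_of_nonneg h0]; exact le_self_add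
      · rw [abs_of_nonpos h0]; exact le_add_self
    refine this.trans_lt ?_
    rw [lintegral_add_left' hX.ereal_toENNReal]
    exact ENNReal.add_lt_top.2 ⟨hp.lt_top, hn.lt_top⟩
  refine ⟨hfin, hint, ?_⟩
  rw [extExp_eq_integral hint hfin] at h
  exact_mod_cast h

end ExtExp

/-! ### The witness condition and the Hellinger divergence -/

section Setting

variable {Z F : Type*} [MeasurableSpace Z] [MeasurableSpace F]
  {P : Measure Z} {loss : F → Z → EReal} {fstar : F} {τ : ℝ → ℝ} {c : ℝ}

lemma IsLearningProblem.measurable_loss (hP : IsLearningProblem P loss) (f : F) :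
    Measurable (loss f) :=
  hP.measurable.comp measurable_prodMk_left

lemma IsLearningProblem.measurable_excessLoss_uncurry (hP : IsLearningProblem P loss) (fstar : F) :
    Measurable (fun p : F × Z => excessLoss loss fstar p.1 p.2) := by
  unfold excessLoss
  simp only [sub_eq_add_neg]
  exact hP.measurable.add ((hP.measurable_loss fstar).comp measurable_snd).neg

lemma IsLearningProblem.measurable_excessLoss (hP : IsLearningProblem P loss) (fstar f : F) :
    Measurable (excessLoss loss fstar f) :=
  (hP.measurable_excessLoss_uncurry fstar).comp measurable_prodMk_left

lemma TauWitness.ae_excessLoss_eq (hP : IsLearningProblem P loss) (hw : TauWitness P loss fstar τ c)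
    (f : F) : ∀ᵐ z ∂P, excessLoss loss fstar f z = ((excessLoss loss fstar f z).toReal : EReal) := by
  obtain ⟨r, hr, -⟩ := hw f
  exact (integrable_of_extExp_eq_coe (hP.measurable_excessLoss fstar f).aemeasurable hr).1

lemma TauWitness.integrable_excessLoss (hP : IsLearningProblem P loss)
    (hw : TauWitness P loss fstar τ c) (f : F) :
    Integrable (fun z => (excessLoss loss fstar f z).toReal) P := by
  obtain ⟨r, hr, -⟩ := hw f
  exact (integrable_of_extExp_eq_coe (hP.measurable_excessLoss fstar f).aemeasurable hr).2.1

/-- A finite excess risk of the comparator itself forces its loss to be a.s. finite, because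
`⊤ - ⊤ = ⊥` in `EReal`. -/
lemma TauWitness.ae_comparator_ne_top (hP : IsLearningProblem P loss)
    (hw : TauWitness P loss fstar τ c) : ∀ᵐ z ∂P, loss fstar z ≠ ⊤ := by
  filter_upwards [hw.ae_excessLoss_eq hP fstar] with z hz h
  unfold excessLoss at hz
  rw [h] at hz
  simp at hz

lemma TauWitness.ae_loss_ne_top (hP : IsLearningProblem P loss)
    (hw : TauWitness P loss fstar τ c) (f : F) : ∀ᵐ z ∂P, loss f z ≠ ⊤ := by
  filter_upwards [hw.ae_excessLoss_eq hP f, hw.ae_comparator_ne_top hP] with z hz hs h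
  unfold excessLoss at hz
  rw [h, ← EReal.coe_toReal hs (hP.ne_bot _ _)] at hz
  simp at hz

lemma TauWitness.ae_toReal_excessLoss (hP : IsLearningProblem P loss)
    (hw : TauWitness P loss fstar τ c) (f : F) :
    ∀ᵐ z ∂P, (excessLoss loss fstar f z).toReal = (loss f z).toReal - (loss fstar z).toReal := by
  filter_upwards [hw.ae_loss_ne_top hP f, hw.ae_comparator_ne_top hP] with z h hs
  exact EReal.toReal_sub h (hP.ne_bot _ _) hs (hP.ne_bot _ _)

lemma TauWitness.integrable_loss (hP : IsLearningProblem P loss)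
    (hw : TauWitness P loss fstar τ c) (f : F) :
    Integrable (fun z => (loss f z).toReal) P := by
  obtain ⟨f₀, hf₀⟩ := hP.nontrivial
  have h0 : Integrable (fun z => (loss f₀ z).toReal) P := by
    have hn := hP.neg_part f₀
    have : ∃ r : ℝ, extExp P (loss f₀) = r := by
      have hp : ∫⁻ z, (loss f₀ z).toENNReal ∂P ≠ ∞ := by
        intro hp
        unfold extExp at hf₀
        rw [hp, ← EReal.coe_ennreal_toReal hn.ne] at hf₀
        simp at hf₀
      refine ⟨(∫⁻ z, (loss f₀ z).toENNReal ∂P).toReal - (∫⁻ z, (-loss f₀ z).toENNReal ∂P).toReal, ?_⟩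
      unfold extExp
      rw [EReal.coe_sub, EReal.coe_ennreal_toReal hp, EReal.coe_ennreal_toReal hn.ne]
    obtain ⟨r, hr⟩ := this
    exact (integrable_of_extExp_eq_coe (hP.measurable_loss f₀).aemeasurable hr).2.1
  have h1 : Integrable (fun z => (loss fstar z).toReal) P := by
    refine (h0.sub (hw.integrable_excessLoss hP f₀)).congr ?_
    filter_upwards [hw.ae_toReal_excessLoss hP f₀] with z hz
    simp [hz]
  refine (h1.add (hw.integrable_excessLoss hP f)).congr ?_
  filter_upwards [hw.ae_toReal_excessLoss hP f] with z hz
  simp [hz]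

/-- `exp (-η (L_f + Y))`: the exponentiated excess loss over the function `loss fstar - Y`, valued in
`ℝ≥0∞` so that an infinite loss gives `0`. -/
noncomputable def expLoss (loss : F → Z → EReal) (fstar : F) (Y : Z → ℝ) (η : ℝ) (f : F) (z : Z) :
    ℝ≥0∞ :=
  EReal.exp (((-η : ℝ) : EReal) * (excessLoss loss fstar f z + (Y z : EReal)))

/-- The function `loss fstar - Y` of the outcome, which need not be the loss of a predictor, is a
pseudo-comparator at rate `θ` with slack `ε`: its risk is at least that of `fstar` minus `ε`, and
`E[exp (-θ (loss f - (loss fstar - Y)))] ≤ 1` for every `f`. -/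
structure IsPseudoComparator (P : Measure Z) (loss : F → Z → EReal) (fstar : F) (θ ε : ℝ)
    (Y : Z → ℝ) : Prop where
  measurable : Measurable Y
  integrable : Integrable Y P
  integral_le : ∫ z, Y z ∂P ≤ ε
  lintegral_expLoss_le : ∀ f, ∫⁻ z, expLoss loss fstar Y θ f z ∂P ≤ 1

/-- The generalized Hellinger divergence `(1 - E[exp (-η (L_f + Y))]) / η` of `f` from the
pseudo-comparator `loss fstar - Y`. -/
noncomputable def hellDiv (P : Measure Z) (loss : F → Z → EReal) (fstar : F) (Y : Z → ℝ) (η : ℝ)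
    (f : F) : ℝ :=
  (1 - (∫⁻ z, expLoss loss fstar Y η f z ∂P).toReal) / η

variable {Y : Z → ℝ} {η θ ε : ℝ}

omit [MeasurableSpace Z] [MeasurableSpace F] in
lemma expLoss_coe {x : ℝ} {f : F} {z : Z} (h : excessLoss loss fstar f z = (x : EReal)) :
    expLoss loss fstar Y η f z = ENNReal.ofReal (Real.exp (-(η * (x + Y z)))) := by
  unfold expLoss
  rw [h, ← EReal.coe_add, ← EReal.coe_mul, EReal.exp_coe, neg_mul]

lemma TauWitness.ae_expLoss (hP : IsLearningProblem P loss)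
    (hw : TauWitness P loss fstar τ c) (Y : Z → ℝ) (η : ℝ) (f : F) :
    ∀ᵐ z ∂P, expLoss loss fstar Y η f z
      = ENNReal.ofReal (Real.exp (-(η * ((excessLoss loss fstar f z).toReal + Y z)))) :=
  (hw.ae_excessLoss_eq hP f).mono fun _ hz => expLoss_coe hz

lemma measurable_expLoss_uncurry (hP : IsLearningProblem P loss) (hY : Measurable Y) :
    Measurable (fun p : F × Z => expLoss loss fstar Y η p.1 p.2) := by
  unfold expLoss
  exact EReal.exp_monotone.measurable.comp (measurable_const.mul
    ((hP.measurable_excessLoss_uncurry fstar).add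
      (measurable_coe_real_ereal.comp (hY.comp measurable_snd))))

lemma measurable_hellDiv [SFinite P] (hP : IsLearningProblem P loss) (hY : Measurable Y) :
    Measurable (hellDiv P loss fstar Y η) := by
  unfold hellDiv
  have := (measurable_expLoss_uncurry (fstar := fstar) (η := η) hP hY).lintegral_prod_right'
    (ν := P)
  exact (measurable_const.sub this.ennreal_toReal).div_const _

/-- Integrability at the rate `θ` passes to smaller rates since `exp (-η t) ≤ 1 + exp (-θ t)`. -/
lemma IsPseudoComparator.integrable_exp [IsProbabilityMeasure P] (hP : IsLearningProblem P loss)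
    (hw : TauWitness P loss fstar τ c)
    (hY : IsPseudoComparator P loss fstar θ ε Y) (hη : 0 < η) (hηθ : η ≤ θ) (f : F) :
    Integrable (fun z => Real.exp (-(η * ((excessLoss loss fstar f z).toReal + Y z)))) P := by
  have hm : ∀ η, AEStronglyMeasurable
      (fun z => Real.exp (-(η * ((excessLoss loss fstar f z).toReal + Y z)))) P := fun η =>
    (Real.measurable_exp.comp ((((hP.measurable_excessLoss fstar f).ereal_toReal.add
      hY.measurable).const_mul η).neg)).aestronglyMeasurable
  have h1 : Integrable (fun z => Real.exp (-(θ * ((excessLoss loss fstar f z).toReal + Y z)))) P := by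
    refine ⟨hm θ, ?_⟩
    have := hY.lintegral_expLoss_le f
    rw [lintegral_congr_ae (hw.ae_expLoss hP Y θ f)] at this
    refine lt_of_le_of_lt ?_ (this.trans_lt ENNReal.one_lt_top)
    refine lintegral_mono fun z => ?_
    rw [Real.enorm_of_nonneg (Real.exp_pos _).le]
  refine ((integrable_const (1 : ℝ)).add h1).mono' (hm η) (ae_of_all _ fun z => ?_)
  rw [Real.norm_of_nonneg (Real.exp_pos _).le, Pi.add_apply]
  set t := (excessLoss loss fstar f z).toReal + Y z
  rcases le_total 0 t with ht | ht
  · have : Real.exp (-(η * t)) ≤ 1 := Real.exp_le_one_iff.2 (by nlinarith)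
    linarith [Real.exp_pos (-(θ * t))]
  · have : Real.exp (-(η * t)) ≤ Real.exp (-(θ * t)) := Real.exp_le_exp.2 (by nlinarith)
    linarith

lemma IsPseudoComparator.lintegral_expLoss_eq_ofReal [IsProbabilityMeasure P]
    (hP : IsLearningProblem P loss)
    (hw : TauWitness P loss fstar τ c)
    (hY : IsPseudoComparator P loss fstar θ ε Y) (hη : 0 < η) (hηθ : η ≤ θ) (f : F) :
    ∫⁻ z, expLoss loss fstar Y η f z ∂P = ENNReal.ofReal
      (∫ z, Real.exp (-(η * ((excessLoss loss fstar f z).toReal + Y z))) ∂P) := by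
  rw [lintegral_congr_ae (hw.ae_expLoss hP Y η f),
    ofReal_integral_eq_lintegral_ofReal (hY.integrable_exp hP hw hη hηθ f)
      (ae_of_all _ fun z => (Real.exp_pos _).le)]

lemma IsPseudoComparator.integrable_hellUtil [IsProbabilityMeasure P] (hP : IsLearningProblem P loss)
    (hw : TauWitness P loss fstar τ c)
    (hY : IsPseudoComparator P loss fstar θ ε Y) (hη : 0 < η) (hηθ : η ≤ θ) (f : F) :
    Integrable (fun z => hellUtil η ((excessLoss loss fstar f z).toReal + Y z)) P := by
  unfold hellUtil
  exact ((integrable_const (1 : ℝ)).sub (hY.integrable_exp hP hw hη hηθ f)).div_const η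

lemma IsPseudoComparator.integral_hellUtil [IsProbabilityMeasure P] (hP : IsLearningProblem P loss)
    (hw : TauWitness P loss fstar τ c)
    (hY : IsPseudoComparator P loss fstar θ ε Y) (hη : 0 < η) (hηθ : η ≤ θ) (f : F) :
    ∫ z, hellUtil η ((excessLoss loss fstar f z).toReal + Y z) ∂P = hellDiv P loss fstar Y η f := by
  unfold hellUtil hellDiv
  rw [integral_div, integral_sub (integrable_const _) (hY.integrable_exp hP hw hη hηθ f),
    hY.lintegral_expLoss_eq_ofReal hP hw hη hηθ f,
    ENNReal.toReal_ofReal (integral_nonneg fun z => (Real.exp_pos _).le)]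
  simp

lemma IsPseudoComparator.hellDiv_anti [IsProbabilityMeasure P] (hP : IsLearningProblem P loss)
    (hw : TauWitness P loss fstar τ c)
    (hY : IsPseudoComparator P loss fstar θ ε Y) (hη : 0 < η) (hηθ : η ≤ θ) (f : F) :
    hellDiv P loss fstar Y θ f ≤ hellDiv P loss fstar Y η f := by
  have hθ : 0 < θ := hη.trans_le hηθ
  rw [← hY.integral_hellUtil hP hw hη hηθ f, ← hY.integral_hellUtil hP hw hθ le_rfl f]
  exact integral_mono (hY.integrable_hellUtil hP hw hθ le_rfl f)
    (hY.integrable_hellUtil hP hw hη hηθ f) fun z => hellUtil_anti hη hηθ _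

omit [MeasurableSpace F] in
lemma IsPseudoComparator.hellDiv_self_nonneg
    (hY : IsPseudoComparator P loss fstar θ ε Y) (hθ : 0 < θ) (f : F) :
    0 ≤ hellDiv P loss fstar Y θ f := by
  unfold hellDiv
  have := ENNReal.toReal_mono ENNReal.one_ne_top (hY.lintegral_expLoss_le f)
  rw [ENNReal.toReal_one] at this
  exact div_nonneg (by linarith) hθ.le

lemma IsPseudoComparator.hellDiv_nonneg [IsProbabilityMeasure P] (hP : IsLearningProblem P loss)
    (hw : TauWitness P loss fstar τ c)
    (hY : IsPseudoComparator P loss fstar θ ε Y) (hη : 0 < η) (hηθ : η ≤ θ) (f : F) :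
    0 ≤ hellDiv P loss fstar Y η f :=
  (hY.hellDiv_self_nonneg (hη.trans_le hηθ) f).trans (hY.hellDiv_anti hP hw hη hηθ f)

omit [MeasurableSpace F] in
lemma hellDiv_le_inv (hη : 0 < η) (f : F) : hellDiv P loss fstar Y η f ≤ 1 / η := by
  unfold hellDiv
  gcongr
  linarith [ENNReal.toReal_nonneg (a := ∫⁻ z, expLoss loss fstar Y η f z ∂P)]

/-- The pointwise inequality `truncated_add_hellUtil_le` in expectation: the utilities at rate `θ`
have nonnegative expectation, that of `Y` because it is the case `f = fstar`. -/
lemma IsPseudoComparator.witness_le [IsProbabilityMeasure P] (hP : IsLearningProblem P loss)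
    (hw : TauWitness P loss fstar τ c)
    (hY : IsPseudoComparator P loss fstar θ ε Y) (hη : 0 < η) (hηθ : 2 * η < θ) (f : F) {r : ℝ}
    (hr : excessRisk P loss fstar f = (r : EReal)) (hτ : 0 ≤ τ r) :
    c * r ≤ (1 + 2 * (η * τ r)) / (1 - 2 * η / θ) * hellDiv P loss fstar Y η f := by
  have hθ : 0 < θ := by linarith
  have hηθ' : η ≤ θ := by linarith
  obtain ⟨r', hr', hwit⟩ := hw f
  obtain rfl : r' = r := by rw [hr] at hr'; exact_mod_cast hr'.symm
  set x : Z → ℝ := fun z => (excessLoss loss fstar f z).toReal with hx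
  have hxi : Integrable x P := hw.integrable_excessLoss hP f
  have hxm : Measurable x := (hP.measurable_excessLoss fstar f).ereal_toReal
  have hti : Integrable (fun z => if x z ≤ τ r' then x z else 0) P := by
    refine hxi.mono (Measurable.ite (measurableSet_le hxm measurable_const) hxm
      measurable_const).aestronglyMeasurable (ae_of_all _ fun z => ?_)
    split_ifs <;> simp
  have h1 : c * r' ≤ ∫ z, (if x z ≤ τ r' then x z else 0) ∂P := by
    rw [extExp_eq_integral hti] at hwit
    · exact_mod_cast hwit
    · filter_upwards [hw.ae_excessLoss_eq hP f] with z hz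
      have : excessLoss loss fstar f z ≤ (τ r' : EReal) ↔ x z ≤ τ r' := by
        rw [hz]; exact EReal.coe_le_coe_iff
      by_cases h : x z ≤ τ r'
      · rw [if_pos (this.2 h), if_pos h]; exact hz
      · rw [if_neg (fun h' => h (this.1 h')), if_neg h]; rfl
  have hstar : ∀ᵐ z ∂P, hellUtil θ ((excessLoss loss fstar fstar z).toReal + Y z)
      = hellUtil θ (Y z) := by
    filter_upwards [hw.ae_toReal_excessLoss hP fstar] with z hz
    rw [hz, sub_self, zero_add]
  have hYi : Integrable (fun z => hellUtil θ (Y z)) P :=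
    (hY.integrable_hellUtil hP hw hθ le_rfl fstar).congr hstar
  have hY0 : 0 ≤ ∫ z, hellUtil θ (Y z) ∂P := by
    rw [← integral_congr_ae hstar, hY.integral_hellUtil hP hw hθ le_rfl fstar]
    exact hY.hellDiv_self_nonneg hθ fstar
  set A := (1 + 2 * (η * τ r')) / (1 - 2 * η / θ) with hA
  have hA1 : 1 ≤ A := by
    have hq : 0 < 1 - 2 * η / θ := by rw [sub_pos, div_lt_one hθ]; exact hηθ
    rw [hA, le_div_iff₀ hq]
    have : 0 < 2 * η / θ := by positivity
    nlinarith [mul_nonneg hη.le hτ]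
  have h2 := integral_mono (hti.add hYi)
    (((hY.integrable_hellUtil hP hw hη hηθ' f).const_mul A).sub
      ((hY.integrable_hellUtil hP hw hθ le_rfl f).const_mul (A - 1)))
    (fun z => truncated_add_hellUtil_le hη hηθ hτ (x z) (Y z))
  rw [integral_add' hti hYi, integral_sub' ((hY.integrable_hellUtil hP hw hη hηθ' f).const_mul A)
    ((hY.integrable_hellUtil hP hw hθ le_rfl f).const_mul (A - 1)), integral_const_mul,
    integral_const_mul, hY.integral_hellUtil hP hw hη hηθ' f,
    hY.integral_hellUtil hP hw hθ le_rfl f] at h2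
  have h3 := mul_nonneg (sub_nonneg.2 hA1) (hY.hellDiv_self_nonneg hθ f)
  linarith

lemma factorC₂_pos {u : ℝ} (hu : 1 ≤ u) (hc : 0 < c) (hη : 0 < η) (hηθ : 2 * η < θ) :
    0 < factorC₂ u c η θ := by
  have hθ : 0 < θ := by linarith
  have hq : 0 < 1 - 2 * η / θ := by rw [sub_pos, div_lt_one hθ]; exact hηθ
  unfold factorC₂
  positivity

/-- With `τ x = u * max 1 x` the bound of `witness_le` holds with the constant `factorC₂`, up to
clipping the excess risk at `1`: for `r > 1` both sides of `witness_le` grow linearly in `r`, and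
only `1 ≤ factorC₂ u c η θ * hellDiv` remains. -/
lemma IsPseudoComparator.min_excessRisk_le [IsProbabilityMeasure P] (hP : IsLearningProblem P loss)
    {u : ℝ} (hu : 1 ≤ u) (hc : 0 < c)
    (hw : TauWitness P loss fstar (fun x => u * max 1 x) c)
    (hY : IsPseudoComparator P loss fstar θ ε Y) (hη : 0 < η) (hηθ : 2 * η < θ) (f : F) {r : ℝ}
    (hr : excessRisk P loss fstar f = (r : EReal)) :
    min r 1 ≤ factorC₂ u c η θ * hellDiv P loss fstar Y η f := by
  have hθ : 0 < θ := by linarith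
  have hq : 0 < 1 - 2 * η / θ := by rw [sub_pos, div_lt_one hθ]; exact hηθ
  have key := hY.witness_le hP hw hη hηθ f hr (by positivity)
  have h0 := hY.hellDiv_nonneg hP hw hη (by linarith) f
  set m := max 1 r with hm
  have hm1 : 1 ≤ m := le_max_left _ _
  set h := hellDiv P loss fstar Y η f
  have e : factorC₂ u c η θ * h = (u * (2 * η + 1)) / (1 - 2 * η / θ) * h / c := by
    unfold factorC₂; field_simp
  have hbd : c * r ≤ m * ((u * (2 * η + 1)) / (1 - 2 * η / θ) * h) := by
    refine key.trans ?_
    rw [show m * ((u * (2 * η + 1)) / (1 - 2 * η / θ) * h)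
      = (m * (u * (2 * η + 1))) / (1 - 2 * η / θ) * h by ring]
    gcongr
    nlinarith [mul_nonneg (by linarith : 0 ≤ u - 1) (by linarith : 0 ≤ m - 1)]
  rw [e, le_div_iff₀ hc]
  rcases le_total r 1 with h1 | h1
  · rw [min_eq_left h1]
    rw [show m = 1 from max_eq_left h1] at hbd
    linarith
  · rw [min_eq_right h1]
    rw [show m = r from max_eq_right h1] at hbd
    refine le_of_mul_le_mul_left ?_ (by linarith : 0 < r)
    linarith

end Setting

/-! ### The Gibbs variational inequality -/

/-- Young's inequality for the convex conjugate pair `klFun` and `exp - 1`. -/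
lemma mul_sub_exp_le_klFun {q : ℝ} (hq : 0 ≤ q) (t : ℝ) :
    q * t + 1 ≤ InformationTheory.klFun q + Real.exp t := by
  rcases hq.eq_or_lt with rfl | hq
  · simp [InformationTheory.klFun_zero, (Real.exp_pos t).le]
  rw [InformationTheory.klFun_apply]
  have h := Real.add_one_le_exp (t - Real.log q)
  have e : Real.exp t = q * Real.exp (t - Real.log q) := by
    rw [Real.exp_sub, Real.exp_log hq]; field_simp
  rw [e]
  nlinarith

lemma young_klFun_ennreal {q : ℝ} (hq : 0 ≤ q) (t : EReal) :
    ENNReal.ofReal q * t.toENNReal + 1 ≤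
      ENNReal.ofReal (InformationTheory.klFun q) + ENNReal.ofReal q * (-t).toENNReal
        + EReal.exp t := by
  induction t with
  | top => simp
  | bot =>
    rcases hq.eq_or_lt with rfl | hq
    · simp [InformationTheory.klFun_zero]
    · simp [ENNReal.mul_top, hq]
  | coe t =>
    have h := mul_sub_exp_le_klFun hq t
    have hk := InformationTheory.klFun_nonneg hq
    rw [EReal.exp_coe, ← EReal.coe_neg, EReal.toENNReal_of_ne_top (EReal.coe_ne_top _),
      EReal.toENNReal_of_ne_top (EReal.coe_ne_top _), EReal.toReal_coe, EReal.toReal_coe,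
      ← ENNReal.ofReal_mul hq, ← ENNReal.ofReal_mul hq, ← ENNReal.ofReal_one]
    rcases le_total 0 t with ht | ht
    · rw [← ENNReal.ofReal_add (mul_nonneg hq ht) zero_le_one,
        ENNReal.ofReal_of_nonpos (mul_nonpos_of_nonneg_of_nonpos hq (neg_nonpos.2 ht)), add_zero,
        ← ENNReal.ofReal_add hk (Real.exp_pos t).le]
      exact ENNReal.ofReal_le_ofReal h
    · rw [ENNReal.ofReal_of_nonpos (mul_nonpos_of_nonneg_of_nonpos hq ht), zero_add,
        ← ENNReal.ofReal_add hk (mul_nonneg hq (neg_nonneg.2 ht)),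
        ← ENNReal.ofReal_add (add_nonneg hk (mul_nonneg hq (neg_nonneg.2 ht))) (Real.exp_pos t).le]
      exact ENNReal.ofReal_le_ofReal (by linarith)

section

variable {F : Type*} [MeasurableSpace F]

/-- A linearized form of the Gibbs variational (Donsker–Varadhan) inequality, without integrability
assumptions: `E_Q[φ] + 1 ≤ KL(Q ‖ ν) + E_ν[exp φ]`, with the negative part of `φ` moved to the
right. -/
lemma lintegral_add_one_le_klDiv_add (Q ν : Measure F) [IsProbabilityMeasure Q]
    [IsProbabilityMeasure ν] {φ : F → EReal} (hφ : Measurable φ) :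
    ∫⁻ f, (φ f).toENNReal ∂Q + 1 ≤
      InformationTheory.klDiv Q ν + ∫⁻ f, (-φ f).toENNReal ∂Q + ∫⁻ f, EReal.exp (φ f) ∂ν := by
  by_cases hac : Q ≪ ν
  swap
  · rw [InformationTheory.klDiv_of_not_ac hac]; simp
  rw [InformationTheory.klDiv_eq_lintegral_klFun_of_ac hac,
    ← lintegral_rnDeriv_mul hac hφ.ereal_toENNReal.aemeasurable,
    ← lintegral_rnDeriv_mul (f := fun f => (-φ f).toENNReal) hac
      hφ.neg.ereal_toENNReal.aemeasurable]
  have hm := Measure.measurable_rnDeriv Q ν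
  have hm1 : Measurable fun f =>
      ENNReal.ofReal (InformationTheory.klFun (Q.rnDeriv ν f).toReal) :=
    (InformationTheory.measurable_klFun.comp hm.ennreal_toReal).ennreal_ofReal
  have hm2 : Measurable fun f => Q.rnDeriv ν f * (-φ f).toENNReal := hm.mul hφ.neg.ereal_toENNReal
  have e1 : (1 : ℝ≥0∞) = ∫⁻ _, 1 ∂ν := by simp
  have hm3 : Measurable fun f =>
      ENNReal.ofReal (InformationTheory.klFun (Q.rnDeriv ν f).toReal)
        + Q.rnDeriv ν f * (-φ f).toENNReal := hm1.add hm2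
  rw [← lintegral_add_left hm1, ← lintegral_add_left hm3, e1,
    ← lintegral_add_right _ measurable_const]
  refine lintegral_mono_ae ?_
  filter_upwards [Measure.rnDeriv_lt_top Q ν] with f hf
  have := young_klFun_ennreal (q := (Q.rnDeriv ν f).toReal) ENNReal.toReal_nonneg (φ f)
  rwa [ENNReal.ofReal_toReal hf.ne] at this

lemma integral_add_one_le_klDiv_add (Q ν : Measure F) [IsProbabilityMeasure Q]
    [IsProbabilityMeasure ν] {φ : F → EReal} (hφ : Measurable φ) {x : F → ℝ} (hx : Integrable x Q)
    (hφx : ∀ᵐ f ∂Q, φ f = (x f : EReal)) (hkl : InformationTheory.klDiv Q ν ≠ ∞)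
    (hexp : ∫⁻ f, EReal.exp (φ f) ∂ν ≠ ∞) :
    ∫ f, x f ∂Q + 1 ≤ (InformationTheory.klDiv Q ν).toReal
      + (∫⁻ f, EReal.exp (φ f) ∂ν).toReal := by
  have key := lintegral_add_one_le_klDiv_add Q ν hφ
  have e1 : ∫⁻ f, (φ f).toENNReal ∂Q = ∫⁻ f, ENNReal.ofReal (x f) ∂Q :=
    lintegral_congr_ae (hφx.mono fun f hf => by simp [hf])
  have e2 : ∫⁻ f, (-φ f).toENNReal ∂Q = ∫⁻ f, ENNReal.ofReal (-x f) ∂Q :=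
    lintegral_congr_ae (hφx.mono fun f hf => by
      simp only [hf, ← EReal.coe_neg, EReal.toENNReal_of_ne_top (EReal.coe_ne_top _),
        EReal.toReal_coe])
  have h1 : ∫⁻ f, ENNReal.ofReal (x f) ∂Q ≠ ∞ := hx.lintegral_lt_top.ne
  have h2 : ∫⁻ f, ENNReal.ofReal (-(x f)) ∂Q ≠ ∞ := hx.neg.lintegral_lt_top.ne
  rw [e1, e2] at key
  rw [integral_eq_lintegral_pos_part_sub_lintegral_neg_part hx]
  have := ENNReal.toReal_mono (by finiteness) key
  rw [ENNReal.toReal_add h1 ENNReal.one_ne_top, ENNReal.toReal_add (by finiteness) hexp,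
    ENNReal.toReal_add hkl h2, ENNReal.toReal_one] at this
  linarith

end

lemma EReal.coe_sum_real {ι : Type*} (s : Finset ι) (x : ι → ℝ) :
    ((∑ i ∈ s, x i : ℝ) : EReal) = ∑ i ∈ s, (x i : EReal) :=
  map_sum (⟨⟨Real.toEReal, rfl⟩, EReal.coe_add⟩ : ℝ →+ EReal) x s

lemma EReal.sum_ne_bot {ι : Type*} {s : Finset ι} {X : ι → EReal} (h : ∀ i ∈ s, X i ≠ ⊥) :
    ∑ i ∈ s, X i ≠ ⊥ := by
  classical
  induction s using Finset.induction_on with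
  | empty => simp
  | insert a s ha ih =>
    rw [Finset.sum_insert ha]
    exact (EReal.add_ne_bot_iff).2 ⟨h a (by simp), ih fun i hi => h i (by simp [hi])⟩

lemma EReal.sum_eq_top {ι : Type*} {s : Finset ι} {X : ι → EReal} (h : ∀ i ∈ s, X i ≠ ⊥)
    {i : ι} (hi : i ∈ s) (hX : X i = ⊤) : ∑ i ∈ s, X i = ⊤ := by
  classical
  rw [← Finset.add_sum_erase s X hi, hX]
  exact EReal.top_add_of_ne_bot (EReal.sum_ne_bot fun j hj => h j (Finset.mem_of_mem_erase hj))

section Setting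

variable {Z F : Type*} [MeasurableSpace Z] [MeasurableSpace F]
  {P : Measure Z} {loss : F → Z → EReal} {fstar : F} {τ : ℝ → ℝ} {c : ℝ}
  {Y : Z → ℝ} {η θ ε : ℝ}

/-- The prior expectation of `exp (η n (h f - (1/n) ∑ (L_f + Y)(z_i)))`, where `h` is the generalized
Hellinger divergence. -/
noncomputable def priorMGF (P : Measure Z) (loss : F → Z → EReal) (fstar : F) (prior : Measure F)
    (Y : Z → ℝ) (η : ℝ) (n : ℕ) (z : Fin n → Z) : ℝ≥0∞ :=
  ∫⁻ f, ENNReal.ofReal (Real.exp (η * n * hellDiv P loss fstar Y η f)) *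
    ∏ i, expLoss loss fstar Y η f (z i) ∂prior

lemma lintegral_pi_prod [IsProbabilityMeasure P] {n : ℕ} {g : Z → ℝ≥0∞} (hg : Measurable g) :
    ∫⁻ z : Fin n → Z, ∏ i, g (z i) ∂(sampleLaw P n) = (∫⁻ z, g z ∂P) ^ n := by
  unfold sampleLaw
  have hind : iIndepFun (fun (i : Fin n) (ω : Fin n → Z) => g (ω i)) (Measure.pi fun _ => P) :=
    iIndepFun_pi (X := fun _ => g) fun _ => hg.aemeasurable
  rw [lintegral_prod_eq_prod_lintegral_of_indepFun _ _ hind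
    fun i => hg.comp (measurable_pi_apply i)]
  have : ∀ i : Fin n, ∫⁻ ω : Fin n → Z, g (ω i) ∂(Measure.pi fun _ => P) = ∫⁻ z, g z ∂P := fun i =>
    (measurePreserving_eval (fun _ : Fin n => P) i).lintegral_comp hg
  simp [this]

lemma measurable_mgf_integrand [SFinite P] (hP : IsLearningProblem P loss) (hY : Measurable Y) (n : ℕ) :
    Measurable (fun p : (Fin n → Z) × F =>
      ENNReal.ofReal (Real.exp (η * n * hellDiv P loss fstar Y η p.2)) *
        ∏ i, expLoss loss fstar Y η p.2 (p.1 i)) := by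
  refine Measurable.mul ?_ (Finset.measurable_prod _ fun i _ => ?_)
  · exact (Real.measurable_exp.comp (((measurable_hellDiv hP hY).comp
      measurable_snd).const_mul _)).ennreal_ofReal
  · exact (measurable_expLoss_uncurry hP hY).comp
      (measurable_snd.prodMk ((measurable_pi_apply i).comp measurable_fst))

lemma measurable_priorMGF [SFinite P] (hP : IsLearningProblem P loss) (hY : Measurable Y) (n : ℕ)
    (prior : Measure F) [SFinite prior] :
    Measurable (priorMGF P loss fstar prior Y η n) :=
  (measurable_mgf_integrand hP hY n).lintegral_prod_right'

/-- By independence this reduces to `exp (1 - e) * e ≤ 1` for `e = E[exp (-η (L_f + Y))]`. -/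
lemma IsPseudoComparator.lintegral_priorMGF_le [IsProbabilityMeasure P] (hP : IsLearningProblem P loss)
    (hw : TauWitness P loss fstar τ c)
    (hY : IsPseudoComparator P loss fstar θ ε Y) (hη : 0 < η) (hηθ : η ≤ θ)
    (prior : Measure F) [IsProbabilityMeasure prior] (n : ℕ) :
    ∫⁻ z, priorMGF P loss fstar prior Y η n z ∂(sampleLaw P n) ≤ 1 := by
  have : IsProbabilityMeasure (sampleLaw P n) := by unfold sampleLaw; infer_instance
  unfold priorMGF
  rw [lintegral_lintegral_swap (measurable_mgf_integrand hP hY.measurable n).aemeasurable]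
  have hle : ∀ f, ∫⁻ z, ENNReal.ofReal (Real.exp (η * n * hellDiv P loss fstar Y η f)) *
      ∏ i, expLoss loss fstar Y η f (z i) ∂(sampleLaw P n) ≤ 1 := by
    intro f
    have hm : Measurable (expLoss loss fstar Y η f) :=
      (measurable_expLoss_uncurry hP hY.measurable).comp measurable_prodMk_left
    have hm' : Measurable fun z : Fin n → Z => ∏ i, expLoss loss fstar Y η f (z i) :=
      Finset.measurable_prod _ fun i _ => hm.comp (measurable_pi_apply i)
    rw [lintegral_const_mul _ hm',
      lintegral_pi_prod hm]
    have he : ∫⁻ z, expLoss loss fstar Y η f z ∂P ≠ ∞ := by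
      rw [hY.lintegral_expLoss_eq_ofReal hP hw hη hηθ f]; exact ENNReal.ofReal_ne_top
    set e := ∫⁻ z, expLoss loss fstar Y η f z ∂P with hedef
    have e1 : η * n * hellDiv P loss fstar Y η f = n * (1 - e.toReal) := by
      unfold hellDiv; rw [← hedef]; field_simp
    rw [e1, Real.exp_nat_mul, ENNReal.ofReal_pow (Real.exp_pos _).le, ← mul_pow]
    refine pow_le_one₀ zero_le ?_
    rw [← ENNReal.ofReal_toReal he, ENNReal.toReal_ofReal ENNReal.toReal_nonneg,
      ← ENNReal.ofReal_mul (Real.exp_pos _).le, ENNReal.ofReal_le_one]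
    have h1 := Real.add_one_le_exp (e.toReal - 1)
    calc Real.exp (1 - e.toReal) * e.toReal
        ≤ Real.exp (1 - e.toReal) * Real.exp (e.toReal - 1) := by gcongr; linarith
      _ = 1 := by rw [← Real.exp_add]; simp
  refine (lintegral_mono hle).trans ?_
  simp

end Setting

/-! ### The information complexity of a single sample -/

section Setting

variable {Z F : Type*} [MeasurableSpace Z] [MeasurableSpace F]
  {P : Measure Z} {loss : F → Z → EReal} {fstar : F} {τ : ℝ → ℝ} {c : ℝ}
  {Y : Z → ℝ} {η θ ε : ℝ}

/-- The empirical mean of the excess loss of `f` on the sample `z`. -/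
noncomputable def empExcess (loss : F → Z → EReal) (fstar : F) {n : ℕ} (z : Fin n → Z) (f : F) : EReal :=
  (((n : ℝ)⁻¹ : ℝ) : EReal) * ∑ i, excessLoss loss fstar f (z i)

lemma measurable_empExcess (hP : IsLearningProblem P loss) {n : ℕ} (z : Fin n → Z) :
    Measurable (empExcess loss fstar z) := by
  unfold empExcess
  refine measurable_const.mul (Finset.measurable_sum _ fun i _ => ?_)
  exact (hP.measurable_excessLoss_uncurry fstar).comp measurable_prodMk_right

lemma excessLoss_ne_bot (hP : IsLearningProblem P loss) {z : Z} (hz : loss fstar z ≠ ⊤) (f : F) :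
    excessLoss loss fstar f z ≠ ⊥ := by
  unfold excessLoss
  rw [sub_eq_add_neg, EReal.add_ne_bot_iff]
  exact ⟨hP.ne_bot f z, by simpa using hz⟩

lemma excessLoss_eq_top (hP : IsLearningProblem P loss) {z : Z} (hz : loss fstar z ≠ ⊤) {f : F}
    (hf : loss f z = ⊤) : excessLoss loss fstar f z = ⊤ := by
  unfold excessLoss
  rw [hf, ← EReal.coe_toReal hz (hP.ne_bot _ _)]; simp

lemma empExcess_eq_top (hP : IsLearningProblem P loss) {n : ℕ} (hn : 1 ≤ n) {z : Fin n → Z}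
    (hz : ∀ i, loss fstar (z i) ≠ ⊤) {f : F} {i : Fin n} (hf : loss f (z i) = ⊤) :
    empExcess loss fstar z f = ⊤ := by
  unfold empExcess
  rw [EReal.sum_eq_top (fun j _ => excessLoss_ne_bot hP (hz j) f) (Finset.mem_univ i)
    (excessLoss_eq_top hP (hz i) hf)]
  have : (0 : ℝ) < n := by exact_mod_cast hn
  exact EReal.coe_mul_top_of_pos (by positivity)

lemma excessLoss_eq_coe (hP : IsLearningProblem P loss) {z : Z} (hz : loss fstar z ≠ ⊤) {f : F}
    (hf : loss f z ≠ ⊤) :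
    excessLoss loss fstar f z = (((loss f z).toReal - (loss fstar z).toReal : ℝ) : EReal) := by
  unfold excessLoss
  rw [EReal.coe_sub, EReal.coe_toReal hf (hP.ne_bot _ _), EReal.coe_toReal hz (hP.ne_bot _ _)]

lemma empExcess_eq_coe (hP : IsLearningProblem P loss) {n : ℕ} {z : Fin n → Z}
    (hz : ∀ i, loss fstar (z i) ≠ ⊤) {f : F} (hf : ∀ i, loss f (z i) ≠ ⊤) :
    empExcess loss fstar z f
      = (((n : ℝ)⁻¹ * ∑ i, ((loss f (z i)).toReal - (loss fstar (z i)).toReal) : ℝ) : EReal) := by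
  unfold empExcess
  rw [EReal.coe_mul, EReal.coe_sum_real]
  congr 1
  exact Finset.sum_congr rfl fun i _ => excessLoss_eq_coe hP (hz i) (hf i)

lemma lintegral_neg_empExcess_lt_top (hP : IsLearningProblem P loss) {n : ℕ} (hn : 1 ≤ n)
    {z : Fin n → Z} (hz : ∀ i, loss fstar (z i) ≠ ⊤) {Q : Measure F} (hQ : IsDistributionOn loss Q) :
    ∫⁻ f, (-(empExcess loss fstar z f)).toENNReal ∂Q < ∞ := by
  have := hQ.1
  have hle : ∀ f, (-(empExcess loss fstar z f)).toENNReal ≤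
      ∑ i, ((-(loss f (z i))).toENNReal + ENNReal.ofReal |(loss fstar (z i)).toReal|) := by
    intro f
    by_cases hf : ∀ i, loss f (z i) ≠ ⊤
    swap
    · push Not at hf
      obtain ⟨i, hi⟩ := hf
      simp [empExcess_eq_top hP hn hz hi]
    have e : ∀ i, (-(loss f (z i))).toENNReal = ENNReal.ofReal (-(loss f (z i)).toReal) := by
      intro i
      rw [← EReal.coe_toReal (hf i) (hP.ne_bot _ _), ← EReal.coe_neg,
        EReal.toENNReal_of_ne_top (EReal.coe_ne_top _)]
      simp
    simp only [empExcess_eq_coe hP hz hf, e, ← EReal.coe_neg,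
      EReal.toENNReal_of_ne_top (EReal.coe_ne_top _), EReal.toReal_coe]
    have e2 : ∀ i, ENNReal.ofReal (-(loss f (z i)).toReal)
        + ENNReal.ofReal |(loss fstar (z i)).toReal|
        = ENNReal.ofReal (max (-(loss f (z i)).toReal) 0 + |(loss fstar (z i)).toReal|) := by
      intro i
      rw [ENNReal.ofReal_add (le_max_right _ _) (abs_nonneg _)]
      simp
    simp only [e2]
    have hnn : ∀ i, 0 ≤ max (-(loss f (z i)).toReal) 0 + |(loss fstar (z i)).toReal| :=
      fun i => add_nonneg (le_max_right _ _) (abs_nonneg _)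
    rw [← ENNReal.ofReal_sum_of_nonneg fun i _ => hnn i]
    refine ENNReal.ofReal_le_ofReal ?_
    have hn1 : (1 : ℝ) ≤ n := by exact_mod_cast hn
    calc -((n : ℝ)⁻¹ * ∑ i, ((loss f (z i)).toReal - (loss fstar (z i)).toReal))
        = (n : ℝ)⁻¹ * ∑ i, (-(loss f (z i)).toReal + (loss fstar (z i)).toReal) := by
          rw [← mul_neg, ← Finset.sum_neg_distrib]; congr 1
          exact Finset.sum_congr rfl fun i _ => by ring
      _ ≤ (n : ℝ)⁻¹ * ∑ i, (max (-(loss f (z i)).toReal) 0 + |(loss fstar (z i)).toReal|) := by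
          gcongr
          · exact le_max_left _ _
          · exact le_abs_self _
      _ ≤ 1 * ∑ i, (max (-(loss f (z i)).toReal) 0 + |(loss fstar (z i)).toReal|) := by
          gcongr
          exact inv_le_one_of_one_le₀ hn1
      _ = _ := one_mul _
  have hm : ∀ i, Measurable fun f => (-(loss f (z i))).toENNReal := fun i =>
    (hP.measurable.comp measurable_prodMk_right).neg.ereal_toENNReal
  refine (lintegral_mono hle).trans_lt ?_
  rw [lintegral_finsetSum _ fun i _ => (hm i).add_const _]
  refine ENNReal.sum_lt_top.2 fun i _ => ?_
  rw [lintegral_add_left (hm i)]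
  refine ENNReal.add_lt_top.2 ⟨hQ.2 (z i), ?_⟩
  simp

/-- The information-theoretic bound for a single sample: `integral_add_one_le_klDiv_add` applied to
`φ f = η n (h f - (1/n) ∑ (L_f + Y)(z_i)) - t`. The choice `t = 0` serves for expectations, and
`t = log (1/δ)` for tail bounds. -/
lemma le_infoComplexity (hP : IsLearningProblem P loss) [SFinite P] {n : ℕ} (hn : 1 ≤ n) (hη : 0 < η)
    (hY : Measurable Y) (hnn : ∀ f, 0 ≤ hellDiv P loss fstar Y η f)
    {prior : Measure F} [IsProbabilityMeasure prior]
    {post : (n : ℕ) → (Fin n → Z) → Measure F} {z : Fin n → Z} (hQ : IsDistributionOn loss (post n z))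
    (hz : ∀ i, loss fstar (z i) ≠ ⊤) (hG : priorMGF P loss fstar prior Y η n z ≠ ∞) (t : ℝ) :
    ((∫ f, hellDiv P loss fstar Y η f ∂(post n z) - (n : ℝ)⁻¹ * ∑ i, Y (z i)
      + (1 - t - Real.exp (-t) * (priorMGF P loss fstar prior Y η n z).toReal) / (η * n) : ℝ) : EReal)
      ≤ infoComplexity loss fstar prior post η n z := by
  have hn0 : (0 : ℝ) < n := by exact_mod_cast hn
  have hηn : 0 < η * n := by positivity
  set Q := post n z with hQdef
  have := hQ.1
  set W := empExcess loss fstar z with hW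
  have hIC : infoComplexity loss fstar prior post η n z
      = extExp Q W + ((InformationTheory.klDiv Q prior : ℝ≥0∞) : EReal) / ((η * n : ℝ) : EReal) := rfl
  rw [hIC]
  have hWm : Measurable W := measurable_empExcess hP z
  have hWneg := lintegral_neg_empExcess_lt_top hP hn hz hQ
  rw [← hW] at hWneg
  have hbot : extExp Q W ≠ ⊥ := by
    unfold extExp
    rw [← EReal.coe_ennreal_toReal hWneg.ne, sub_eq_add_neg, ← EReal.coe_neg, EReal.add_ne_bot_iff]
    exact ⟨EReal.coe_ennreal_ne_bot _, EReal.coe_ne_bot _⟩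
  -- If the divergence or the posterior mean of the loss is infinite, so is the information complexity.
  by_cases hkl : InformationTheory.klDiv Q prior = ∞
  · rw [hkl, EReal.coe_ennreal_top,
      EReal.top_div_of_pos_ne_top (by exact_mod_cast hηn) (EReal.coe_ne_top _),
      EReal.add_top_of_ne_bot hbot]
    exact le_top
  by_cases hWpos : ∫⁻ f, (W f).toENNReal ∂Q = ∞
  · have : extExp Q W = ⊤ := by
      unfold extExp
      rw [hWpos, ← EReal.coe_ennreal_toReal hWneg.ne]; simp
    rw [this, EReal.top_add_of_ne_bot]
    · exact le_top
    · exact (lt_of_lt_of_le (EReal.bot_lt_zero)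
        (EReal.div_nonneg (EReal.coe_ennreal_nonneg _) (by exact_mod_cast hηn.le))).ne'
  have hWr : extExp Q W = (((∫⁻ f, (W f).toENNReal ∂Q).toReal
      - (∫⁻ f, (-(W f)).toENNReal ∂Q).toReal : ℝ) : EReal) := by
    unfold extExp
    rw [EReal.coe_sub, EReal.coe_ennreal_toReal hWpos, EReal.coe_ennreal_toReal hWneg.ne]
  obtain ⟨hWfin, hWint, hWeq⟩ := integrable_of_extExp_eq_coe hWm.aemeasurable hWr
  rw [← hWeq] at hWr
  set h := hellDiv P loss fstar Y η with hh
  have hhm : Measurable h := measurable_hellDiv hP hY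
  have hhi : Integrable h Q := by
    refine (integrable_const (1 / η)).mono' hhm.aestronglyMeasurable (ae_of_all _ fun f => ?_)
    rw [Real.norm_of_nonneg (hnn f)]
    exact hellDiv_le_inv hη f
  set Ybar := (n : ℝ)⁻¹ * ∑ i, Y (z i) with hYbar
  set G := priorMGF P loss fstar prior Y η n z with hGdef
  set φ : F → EReal := fun f => ((η * n * (h f - Ybar) - t : ℝ) : EReal) - ((η * n : ℝ) : EReal) * W f
    with hφ
  have hφm : Measurable φ := by
    simp only [hφ, sub_eq_add_neg]
    exact ((((hhm.sub_const Ybar).const_mul (η * n)).sub_const t).coe_real_ereal).add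
      (measurable_const.mul hWm).neg
  have hexp : ∫⁻ f, EReal.exp (φ f) ∂prior = ENNReal.ofReal (Real.exp (-t)) * G := by
    rw [hGdef]
    unfold priorMGF
    rw [← lintegral_const_mul' _ _ ENNReal.ofReal_ne_top]
    refine lintegral_congr fun f => ?_
    by_cases hf : ∀ i, loss f (z i) ≠ ⊤
    · have e1 : ∀ i, expLoss loss fstar Y η f (z i) = ENNReal.ofReal (Real.exp
          (-(η * ((loss f (z i)).toReal - (loss fstar (z i)).toReal + Y (z i))))) := fun i =>
        expLoss_coe (excessLoss_eq_coe hP (hz i) (hf i))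
      simp only [hφ, hW, e1, empExcess_eq_coe hP hz hf]
      rw [← ENNReal.ofReal_prod_of_nonneg fun i _ => (Real.exp_pos _).le, ← EReal.coe_mul,
        ← EReal.coe_sub, EReal.exp_coe, ← ENNReal.ofReal_mul (Real.exp_pos _).le,
        ← ENNReal.ofReal_mul (Real.exp_pos _).le, ← Real.exp_sum, ← Real.exp_add, ← Real.exp_add]
      congr 2
      rw [Finset.sum_neg_distrib, ← Finset.mul_sum, Finset.sum_add_distrib, hYbar]
      field_simp
      ring
    -- an infinite loss in the sample makes `φ f = ⊥`, and both integrands vanish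
    · push Not at hf
      obtain ⟨i, hi⟩ := hf
      have e1 : expLoss loss fstar Y η f (z i) = 0 := by
        unfold expLoss
        rw [excessLoss_eq_top hP (hz i) hi, EReal.top_add_coe, EReal.coe_mul_top_of_neg (by linarith), EReal.exp_bot]
      rw [Finset.prod_eq_zero (Finset.mem_univ i) e1, mul_zero, mul_zero]
      simp only [hφ, hW, empExcess_eq_top hP hn hz hi]
      rw [EReal.coe_mul_top_of_pos hηn]
      simp
  set x : F → ℝ := fun f => (η * n * (h f - Ybar) - t) - η * n * (W f).toReal with hx
  have hxi : Integrable x Q := by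
    refine Integrable.sub (Integrable.sub ?_ (integrable_const t)) (hWint.const_mul _)
    exact (hhi.sub (integrable_const Ybar)).const_mul _
  have hφx : ∀ᵐ f ∂Q, φ f = (x f : EReal) := by
    filter_upwards [hWfin] with f hf
    simp only [hφ, hx]
    rw [hf, EReal.toReal_coe, ← EReal.coe_mul, ← EReal.coe_sub]
  have key := integral_add_one_le_klDiv_add Q prior hφm hxi hφx hkl (by
    rw [hexp]; exact ENNReal.mul_ne_top ENNReal.ofReal_ne_top hG)
  rw [hexp, ENNReal.toReal_mul, ENNReal.toReal_ofReal (Real.exp_pos _).le] at key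
  have hxint : ∫ f, x f ∂Q = η * n * (∫ f, h f ∂Q - Ybar) - t - η * n * ∫ f, (W f).toReal ∂Q := by
    simp only [hx]
    rw [integral_sub, integral_sub, integral_const_mul, integral_const_mul, integral_sub hhi
      (integrable_const _)]
    · simp
    · exact (hhi.sub (integrable_const Ybar)).const_mul _
    · exact integrable_const t
    · exact Integrable.sub ((hhi.sub (integrable_const Ybar)).const_mul _) (integrable_const t)
    · exact hWint.const_mul _
  rw [hWr, ← EReal.coe_ennreal_toReal hkl, ← EReal.coe_div, ← EReal.coe_add, EReal.coe_le_coe_iff]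
  rw [hxint] at key
  have e : ∫ f, h f ∂Q - Ybar + (1 - t - Real.exp (-t) * G.toReal) / (η * n)
      = (η * n * (∫ f, h f ∂Q - Ybar) + (1 - t - Real.exp (-t) * G.toReal)) / (η * n) := by
    field_simp
  have e' : ∫ f, (W f).toReal ∂Q + (InformationTheory.klDiv Q prior).toReal / (η * n)
      = (η * n * ∫ f, (W f).toReal ∂Q + (InformationTheory.klDiv Q prior).toReal) / (η * n) := by
    field_simp
  rw [e, e']
  gcongr ?_ / _
  linarith

end Setting

/-! ### The reverse information projection -/

lemma exp_mul_sub_sq_le_cosh {β : ℝ} (h0 : 0 ≤ β) (h1 : β < 1) (s : ℝ) :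
    Real.exp (β * s - β ^ 2) ≤ (Real.exp s + Real.exp (-s)) / 2 := by
  -- Jensen's inequality for the weights `(1 ± β) / 2`, with tangent lines of `exp` at `β s - β²`.
  set y := β * s - β ^ 2 with hy
  have t1 : (1 + β) * (Real.exp y * (1 + (s - β - y))) ≤ Real.exp s := by
    have a1 := Real.add_one_le_exp (s - β - y)
    have a2 := Real.add_one_le_exp β
    have e : Real.exp s = Real.exp β * (Real.exp y * Real.exp (s - β - y)) := by
      rw [← Real.exp_add, ← Real.exp_add]; ring_nf
    rw [e]
    calc _ ≤ (1 + β) * (Real.exp y * Real.exp (s - β - y)) := by gcongr; linarith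
      _ ≤ _ := by gcongr; linarith
  have t2 : (1 - β) * (Real.exp y * (1 + (-s + β - y))) ≤ Real.exp (-s) := by
    have a1 := Real.add_one_le_exp (-s + β - y)
    have a2 := Real.add_one_le_exp (-β)
    have e : Real.exp (-s) = Real.exp (-β) * (Real.exp y * Real.exp (-s + β - y)) := by
      rw [← Real.exp_add, ← Real.exp_add]; ring_nf
    rw [e]
    have : 0 < 1 - β := by linarith
    calc _ ≤ (1 - β) * (Real.exp y * Real.exp (-s + β - y)) := by gcongr; linarith
      _ ≤ _ := by gcongr; linarith
  have e : (1 + β) * (Real.exp y * (1 + (s - β - y))) + (1 - β) * (Real.exp y * (1 + (-s + β - y)))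
      = 2 * Real.exp y * (1 + (β * s - β ^ 2 - y)) := by ring
  have e2 : β * s - β ^ 2 - y = 0 := by rw [hy]; ring
  rw [e2] at e
  linarith

/-- A quantitative midpoint convexity of `exp`, with a gain linear in `|a - b|` up to `β ^ 2`. -/
lemma exp_neg_midpoint_le {β : ℝ} (h0 : 0 ≤ β) (h1 : β < 1) (a b : ℝ) :
    Real.exp (-((a + b) / 2 - β / 2 * |a - b| + β ^ 2)) ≤ (Real.exp (-a) + Real.exp (-b)) / 2 := by
  wlog hab : a ≤ b generalizing a b
  · have := this b a (le_of_not_ge hab)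
    rwa [add_comm b a, abs_sub_comm b a, add_comm (Real.exp (-b))] at this
  have h := exp_mul_sub_sq_le_cosh h0 h1 ((b - a) / 2)
  have e1 : Real.exp (-a) = Real.exp (-((a + b) / 2)) * Real.exp ((b - a) / 2) := by
    rw [← Real.exp_add]; ring_nf
  have e2 : Real.exp (-b) = Real.exp (-((a + b) / 2)) * Real.exp (-((b - a) / 2)) := by
    rw [← Real.exp_add]; ring_nf
  have e3 : -((a + b) / 2 - β / 2 * |a - b| + β ^ 2)
      = -((a + b) / 2) + (β * ((b - a) / 2) - β ^ 2) := by
    rw [abs_of_nonpos (by linarith)]; ring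
  rw [e3, Real.exp_add, e1, e2, ← mul_add, mul_div_assoc]
  gcongr

lemma sub_sq_le_log_one_add {x : ℝ} (hx : -(1 / 2) ≤ x) : x - x ^ 2 ≤ Real.log (1 + x) := by
  have h1 := Real.one_sub_inv_le_log_of_pos (by linarith : 0 < 1 + x)
  have h2 : 1 - (1 + x)⁻¹ = x / (1 + x) := by
    have : 1 + x ≠ 0 := by linarith
    field_simp; ring
  rcases le_total 0 x with h0 | h0
  · refine le_trans ?_ h1
    rw [h2, le_div_iff₀ (by linarith)]
    nlinarith [mul_nonneg h0 (mul_nonneg h0 h0)]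
  · -- for `x ∈ [-1/2, 0]` the derivative of `log (1 + x) - x + x ^ 2` is `x (1 + 2 x) / (1 + x) ≤ 0`
    set ψ : ℝ → ℝ := fun x => Real.log (1 + x) - x + x ^ 2 with hψ
    have hd : ∀ y, -1 < y → HasDerivAt ψ (1 / (1 + y) - 1 + 2 * y) y := by
      intro y hy
      have h1 : HasDerivAt (fun x : ℝ => Real.log (1 + x)) (1 / (1 + y)) y :=
        ((hasDerivAt_id y).const_add 1).log (by linarith : (0 : ℝ) < 1 + y).ne'
      have h2 : HasDerivAt (fun x : ℝ => x ^ 2) (2 * y) y := by simpa using hasDerivAt_pow 2 y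
      exact (h1.sub (hasDerivAt_id y)).add h2
    have hanti : ψ 0 ≤ ψ x := by
      refine antitoneOn_of_deriv_nonpos (convex_Icc x 0)
        (fun y hy => (hd y (by linarith [hy.1])).continuousAt.continuousWithinAt)
        (fun y hy => (hd y (by rw [interior_Icc] at hy; linarith [hy.1])).differentiableAt.differentiableWithinAt)
        ?_ (Set.left_mem_Icc.2 h0) (Set.right_mem_Icc.2 h0) h0
      intro y hy
      rw [interior_Icc] at hy
      rw [(hd y (by linarith [hy.1])).deriv]
      have hy1 : 0 < 1 + y := by linarith [hy.1]
      have e : 1 / (1 + y) - 1 + 2 * y = y * (1 + 2 * y) / (1 + y) := by field_simp; ring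
      rw [e]
      refine div_nonpos_of_nonpos_of_nonneg ?_ hy1.le
      nlinarith [hy.1, hy.2]
    simp only [hψ, add_zero, Real.log_one] at hanti
    linarith

/-- The likelihood ratio `q / exp (-l)`, truncated at `K` so as to be a real number. -/
noncomputable def truncRatio (K : ℕ) (q : ℝ≥0∞) (l : ℝ) : ℝ :=
  (min (q * ENNReal.ofReal (Real.exp l)) K).toReal

lemma truncRatio_nonneg (K : ℕ) (q : ℝ≥0∞) (l : ℝ) : 0 ≤ truncRatio K q l := ENNReal.toReal_nonneg

lemma truncRatio_le (K : ℕ) (q : ℝ≥0∞) (l : ℝ) : truncRatio K q l ≤ K :=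
  ENNReal.toReal_le_of_le_ofReal (by positivity) (by simp)

lemma ofReal_truncRatio (K : ℕ) (q : ℝ≥0∞) (l : ℝ) :
    ENNReal.ofReal (truncRatio K q l) = min (q * ENNReal.ofReal (Real.exp l)) K :=
  ENNReal.ofReal_toReal (ne_top_of_le_ne_top (ENNReal.natCast_ne_top K) (min_le_right _ _))

lemma ofReal_exp_neg_mul_truncRatio_le (K : ℕ) (q : ℝ≥0∞) (l : ℝ) :
    ENNReal.ofReal (Real.exp (-l) * truncRatio K q l) ≤ q := by
  rw [ENNReal.ofReal_mul (Real.exp_pos _).le, ofReal_truncRatio]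
  calc _ ≤ ENNReal.ofReal (Real.exp (-l)) * (q * ENNReal.ofReal (Real.exp l)) := by
        gcongr; exact min_le_left _ _
    _ = q * ENNReal.ofReal (Real.exp (-l) * Real.exp l) := by
        rw [ENNReal.ofReal_mul (Real.exp_pos _).le]; ring
    _ = q := by rw [← Real.exp_add]; simp

lemma tendsto_truncRatio (K : ℕ) (q : ℝ≥0∞) {l : ℕ → ℝ} {l' : ℝ} (h : Tendsto l atTop (𝓝 l')) :
    Tendsto (fun k => truncRatio K q (l k)) atTop (𝓝 (truncRatio K q l')) := by
  unfold truncRatio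
  refine (ENNReal.tendsto_toReal (ne_top_of_le_ne_top (ENNReal.natCast_ne_top K)
    (min_le_right _ _))).comp (Tendsto.min ?_ tendsto_const_nhds)
  refine ENNReal.Tendsto.const_mul (ENNReal.tendsto_ofReal ((Real.continuous_exp.tendsto _).comp h))
    (Or.inl ?_)
  simp [Real.exp_pos]

lemma AEMeasurable.truncRatio {Z : Type*} [MeasurableSpace Z] {P : Measure Z} (K : ℕ)
    {q : Z → ℝ≥0∞} {l : Z → ℝ} (hq : AEMeasurable q P) (hl : AEMeasurable l P) :
    AEMeasurable (fun z => _root_.truncRatio K (q z) (l z)) P := by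
  unfold _root_.truncRatio
  exact ((hq.mul (Real.measurable_exp.comp_aemeasurable hl).ennreal_ofReal).min
    aemeasurable_const).ennreal_toReal

lemma norm_log_truncRatio_le {t : ℝ} (h0 : 0 < t) (h1 : t < 1) (K : ℕ) (q : ℝ≥0∞) (l : ℝ) :
    ‖Real.log (1 + t * (truncRatio K q l - 1))‖ ≤ |Real.log (1 - t)| + |Real.log (1 + K)| := by
  have hz0 := truncRatio_nonneg K q l
  have hz1 := truncRatio_le K q l
  have a1 := Real.log_le_log (by linarith)
    (by nlinarith : 1 - t ≤ 1 + t * (truncRatio K q l - 1))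
  have a2 := Real.log_le_log (by nlinarith)
    (by nlinarith : 1 + t * (truncRatio K q l - 1) ≤ 1 + (K : ℝ))
  rw [Real.norm_eq_abs, abs_le]
  constructor
  · linarith [neg_abs_le (Real.log (1 - t)), abs_nonneg (Real.log (1 + (K : ℝ)))]
  · linarith [le_abs_self (Real.log (1 + (K : ℝ))), abs_nonneg (Real.log (1 - t))]

lemma AEMeasurable.log_truncRatio {Z : Type*} [MeasurableSpace Z] {P : Measure Z} (K : ℕ) (t : ℝ)
    {q : Z → ℝ≥0∞} {l : Z → ℝ} (hq : AEMeasurable q P) (hl : AEMeasurable l P) :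
    AEMeasurable (fun z => Real.log (1 + t * (_root_.truncRatio K (q z) (l z) - 1))) P :=
  Real.measurable_log.comp_aemeasurable
    ((((hq.truncRatio K hl).sub_const 1).const_mul t).const_add 1)

lemma integrable_log_truncRatio {Z : Type*} [MeasurableSpace Z] {P : Measure Z} [IsFiniteMeasure P]
    (K : ℕ) {t : ℝ} (h0 : 0 < t) (h1 : t < 1)
    {q : Z → ℝ≥0∞} {l : Z → ℝ} (hq : AEMeasurable q P) (hl : AEMeasurable l P) :
    Integrable (fun z => Real.log (1 + t * (truncRatio K (q z) (l z) - 1))) P :=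
  (integrable_const (|Real.log (1 - t)| + |Real.log (1 + K)|)).mono'
    (hq.log_truncRatio K t hl).aestronglyMeasurable
    (ae_of_all _ fun _ => norm_log_truncRatio_le h0 h1 K _ _)

section Projection

variable {Z : Type*} [MeasurableSpace Z] {P : Measure Z} [IsProbabilityMeasure P]

/-- A convex class of nonnegative functions whose infimal log loss `inf_q E[-log q]` is `m`, not
necessarily attained. To allow `q` to vanish or to be infinite, the log loss is described by integrable
functions `x` with `exp (-x) ≤ q`, respectively `exp (-x) = q`. -/
structure IsMixtureClass (P : Measure Z) (𝒬 : Set (Z → ℝ≥0∞)) (m : ℝ) : Prop where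
  measurable : ∀ q ∈ 𝒬, Measurable q
  convex : ∀ q ∈ 𝒬, ∀ q' ∈ 𝒬, ∀ t : ℝ, 0 ≤ t → t ≤ 1 →
    (fun z => ENNReal.ofReal (1 - t) * q z + ENNReal.ofReal t * q' z) ∈ 𝒬
  le_integral : ∀ q ∈ 𝒬, ∀ x : Z → ℝ, Integrable x P →
    (∀ᵐ z ∂P, ENNReal.ofReal (Real.exp (-x z)) ≤ q z) → m ≤ ∫ z, x z ∂P
  exists_lt : ∀ γ : ℝ, 0 < γ → ∃ q ∈ 𝒬, ∃ x : Z → ℝ, Integrable x P ∧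
    (∀ᵐ z ∂P, q z = ENNReal.ofReal (Real.exp (-x z))) ∧ ∫ z, x z ∂P < m + γ

variable {𝒬 : Set (Z → ℝ≥0∞)} {m : ℝ}

/-- Two near-minimizers of the log loss are close in `L¹`, since otherwise their midpoint would beat
the infimum. -/
lemma IsMixtureClass.integral_abs_sub_le (h𝒬 : IsMixtureClass P 𝒬 m) {q q' : Z → ℝ≥0∞}
    (hq : q ∈ 𝒬) (hq' : q' ∈ 𝒬) {x x' : Z → ℝ} (hx : Integrable x P) (hx' : Integrable x' P)
    (hqx : ∀ᵐ z ∂P, q z = ENNReal.ofReal (Real.exp (-x z)))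
    (hqx' : ∀ᵐ z ∂P, q' z = ENNReal.ofReal (Real.exp (-x' z))) {γ β : ℝ}
    (hγ : ∫ z, x z ∂P ≤ m + γ) (hγ' : ∫ z, x' z ∂P ≤ m + γ) (h0 : 0 < β) (h1 : β < 1) :
    ∫ z, |x z - x' z| ∂P ≤ 2 * γ / β + 2 * β := by
  have hab : Integrable (fun z => |x z - x' z|) P := (hx.sub hx').abs
  have hi1 : Integrable (fun z => (x z + x' z) / 2) P := (hx.add hx').div_const 2
  have hi2 : Integrable (fun z => β / 2 * |x z - x' z|) P := hab.const_mul _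
  have key := h𝒬.le_integral _ (h𝒬.convex q hq q' hq' (1 / 2) (by norm_num) (by norm_num))
    (fun z => (x z + x' z) / 2 - β / 2 * |x z - x' z| + β ^ 2)
    ((hi1.sub hi2).add (integrable_const _)) (by
      filter_upwards [hqx, hqx'] with z hz hz'
      rw [hz, hz', ← ENNReal.ofReal_mul (by norm_num), ← ENNReal.ofReal_mul (by norm_num),
        ← ENNReal.ofReal_add (by positivity) (by positivity)]
      refine ENNReal.ofReal_le_ofReal ((exp_neg_midpoint_le h0.le h1 _ _).trans (le_of_eq ?_))
      ring)
  rw [integral_add (f := fun z => (x z + x' z) / 2 - β / 2 * |x z - x' z|) (hi1.sub hi2)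
    (integrable_const _), integral_sub hi1 hi2, integral_const_mul,
    integral_div, integral_add hx hx', integral_const] at key
  simp only [probReal_univ, one_smul] at key
  have e : 2 * γ / β + 2 * β = (2 * γ + 2 * β ^ 2) / β := by field_simp
  rw [e, le_div_iff₀ h0]
  linarith

/-- The first-order condition at a near-minimizer `exp (-x)`, in the direction of `q'`. The truncation
of the likelihood ratio makes the logarithm bounded. -/
lemma IsMixtureClass.integral_log_truncRatio_le (h𝒬 : IsMixtureClass P 𝒬 m) {q q' : Z → ℝ≥0∞}
    (hq : q ∈ 𝒬) (hq' : q' ∈ 𝒬) {x : Z → ℝ} (hx : Integrable x P)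
    (hqx : ∀ᵐ z ∂P, q z = ENNReal.ofReal (Real.exp (-x z))) {γ t : ℝ}
    (hγ : ∫ z, x z ∂P ≤ m + γ) (h0 : 0 < t) (h1 : t < 1) (K : ℕ) :
    ∫ z, Real.log (1 + t * (truncRatio K (q' z) (x z) - 1)) ∂P ≤ γ := by
  have hpos : ∀ z, 1 - t ≤ 1 + t * (truncRatio K (q' z) (x z) - 1) := fun z => by
    nlinarith [truncRatio_nonneg K (q' z) (x z)]
  have hi := integrable_log_truncRatio K h0 h1 (h𝒬.measurable q' hq').aemeasurable hx.aemeasurable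
  have key := h𝒬.le_integral _ (h𝒬.convex q hq q' hq' t h0.le h1.le)
    (fun z => x z - Real.log (1 + t * (truncRatio K (q' z) (x z) - 1))) (hx.sub hi) (by
      filter_upwards [hqx] with z hz
      rw [neg_sub, sub_eq_add_neg, Real.exp_add, Real.exp_log (by linarith [hpos z]), hz]
      have e : (1 + t * (truncRatio K (q' z) (x z) - 1)) * Real.exp (-x z)
          = (1 - t) * Real.exp (-x z) + t * (Real.exp (-x z) * truncRatio K (q' z) (x z)) := by ring
      have : 0 < 1 - t := by linarith
      rw [e, ENNReal.ofReal_add (by positivity)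
        (mul_nonneg h0.le (mul_nonneg (Real.exp_pos _).le (truncRatio_nonneg _ _ _))),
        ENNReal.ofReal_mul this.le, ENNReal.ofReal_mul h0.le]
      gcongr
      exact ofReal_exp_neg_mul_truncRatio_le K _ _)
  rw [integral_sub hx hi] at key
  linarith

/-- Existence of the generalized reverse information projection: minimizing sequences converge in
`L¹` to some `g` with `E[g] = m`, and the first-order conditions become `E[q exp g] ≤ 1` in the
limit. -/
lemma IsMixtureClass.exists_projection (h𝒬 : IsMixtureClass P 𝒬 m) :
    ∃ g : Z → ℝ, Measurable g ∧ Integrable g P ∧ ∫ z, g z ∂P = m ∧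
      ∀ q ∈ 𝒬, ∫⁻ z, q z * ENNReal.ofReal (Real.exp (g z)) ∂P ≤ 1 := by
  choose q hq x hx hqx hxm using fun k : ℕ => h𝒬.exists_lt ((1 / 4) ^ k) (by positivity)
  have hcau : ∀ N n k : ℕ, N ≤ n → N ≤ k →
      eLpNorm (x n - x k) 1 P < ENNReal.ofReal (6 * (1 / 2) ^ N) := by
    intro N n k hn hk
    have hp2 : (0 : ℝ) < (1 / 2) ^ N := by positivity
    have hp21 : ((1 : ℝ) / 2) ^ N ≤ 1 := pow_le_one₀ (by norm_num) (by norm_num)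
    have e4 : ((1 : ℝ) / 4) ^ N = (1 / 2) ^ N * (1 / 2) ^ N := by rw [← mul_pow]; norm_num
    have hg : ∀ j, N ≤ j → ∫ z, x j z ∂P ≤ m + (1 / 4) ^ N := fun j hj =>
      (hxm j).le.trans (by
        have := pow_le_pow_of_le_one (by norm_num : (0:ℝ) ≤ 1 / 4) (by norm_num) hj
        linarith)
    -- with excess `4⁻ᴺ`, the choice `β = 2⁻ᴺ / 2` balances the two error terms
    have := h𝒬.integral_abs_sub_le (hq n) (hq k) (hx n) (hx k) (hqx n) (hqx k) (hg n hn) (hg k hk)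
      (β := (1 / 2) ^ N / 2) (by positivity) (by linarith)
    have e : 2 * (1 / 4) ^ N / ((1 / 2) ^ N / 2) + 2 * ((1 / 2) ^ N / 2) = (5 : ℝ) * (1 / 2) ^ N := by
      rw [e4]; field_simp; ring
    rw [e] at this
    rw [eLpNorm_one_eq_lintegral_enorm]
    have e' : ∫⁻ z, ‖(x n - x k) z‖ₑ ∂P = ENNReal.ofReal (∫ z, |x n z - x k z| ∂P) := by
      have hi : Integrable (fun z => |x n z - x k z|) P := ((hx n).sub (hx k)).abs
      rw [ofReal_integral_eq_lintegral_ofReal hi (ae_of_all _ fun z => abs_nonneg _)]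
      exact lintegral_congr fun z => Real.enorm_eq_ofReal_abs _
    rw [e']
    exact (ENNReal.ofReal_lt_ofReal_iff (by positivity)).2 (by linarith)
  have hB : ∑' N : ℕ, ENNReal.ofReal (6 * (1 / 2) ^ N) ≠ ∞ :=
    (summable_geometric_two.mul_left 6).tsum_ofReal_ne_top
  obtain ⟨g₀, hg₀, hlim⟩ := Lp.cauchy_complete_eLpNorm le_rfl
    (fun n => memLp_one_iff_integrable.2 (hx n)) hB hcau
  have hg₀i : Integrable g₀ P := memLp_one_iff_integrable.1 hg₀
  set g := hg₀i.1.mk g₀ with hgdef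
  have hgg : g₀ =ᵐ[P] g := hg₀i.1.ae_eq_mk
  have hgi : Integrable g P := hg₀i.congr hgg
  have hlim' : Tendsto (fun n => eLpNorm (x n - g) 1 P) atTop (𝓝 0) := by
    refine hlim.congr fun n => eLpNorm_congr_ae ?_
    filter_upwards [hgg] with z hz
    simp [hz]
  have hint : Tendsto (fun n => ∫ z, x n z ∂P) atTop (𝓝 (∫ z, g z ∂P)) :=
    tendsto_integral_of_L1' g hgi.1 (Eventually.of_forall hx) hlim'
  have hint2 : Tendsto (fun n => ∫ z, x n z ∂P) atTop (𝓝 m) := by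
    refine tendsto_of_tendsto_of_tendsto_of_le_of_le tendsto_const_nhds
      (h := fun n => m + (1 / 4) ^ n) ?_ (fun n => ?_) (fun n => (hxm n).le)
    · have := (tendsto_pow_atTop_nhds_zero_of_lt_one (by norm_num : (0:ℝ) ≤ 1 / 4)
        (by norm_num)).const_add m
      simpa using this
    · exact h𝒬.le_integral _ (hq n) _ (hx n) ((hqx n).mono fun z hz => hz.ge)
  obtain ⟨ns, hns, hae⟩ := (tendstoInMeasure_of_tendsto_eLpNorm one_ne_zero
    (fun n => (hx n).1) hgi.1 hlim').exists_seq_tendsto_ae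
  refine ⟨g, hg₀i.1.stronglyMeasurable_mk.measurable, hgi, tendsto_nhds_unique hint hint2, ?_⟩
  intro q' hq'
  -- the first-order condition passes to the limit for each truncation level and each step `t`
  have hlog : ∀ (K : ℕ) (t : ℝ), 0 < t → t < 1 →
      ∫ z, Real.log (1 + t * (truncRatio K (q' z) (g z) - 1)) ∂P ≤ 0 := by
    intro K t h0 h1
    have hpos : ∀ z (l : ℝ), 1 - t ≤ 1 + t * (truncRatio K (q' z) l - 1) := fun z l => by
      nlinarith [truncRatio_nonneg K (q' z) l]
    have hdom : Tendsto (fun i => ∫ z, Real.log (1 + t * (truncRatio K (q' z) (x (ns i) z) - 1)) ∂P)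
        atTop (𝓝 (∫ z, Real.log (1 + t * (truncRatio K (q' z) (g z) - 1)) ∂P)) := by
      refine tendsto_integral_of_dominated_convergence
        (fun _ => |Real.log (1 - t)| + |Real.log (1 + K)|) (fun i => ?_) (integrable_const _)
        (fun i => ae_of_all _ fun z => ?_) ?_
      · exact ((h𝒬.measurable q' hq').aemeasurable.log_truncRatio K t
          (hx (ns i)).aemeasurable).aestronglyMeasurable
      · exact norm_log_truncRatio_le h0 h1 K _ _
      · filter_upwards [hae] with z hz
        exact (Real.continuousAt_log (by linarith [hpos z (g z)])).tendsto.comp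
          (((tendsto_truncRatio K (q' z) hz).sub_const 1).const_mul t |>.const_add 1)
    have hγ : Tendsto (fun i => ((1 : ℝ) / 4) ^ (ns i)) atTop (𝓝 0) :=
      (tendsto_pow_atTop_nhds_zero_of_lt_one (by norm_num) (by norm_num)).comp hns.tendsto_atTop
    exact le_of_tendsto_of_tendsto' hdom hγ fun i =>
      h𝒬.integral_log_truncRatio_le (hq (ns i)) hq' (hx (ns i)) (hqx (ns i)) (hxm (ns i)).le h0 h1 K
  have hK : ∀ K : ℕ, ∫⁻ z, min (q' z * ENNReal.ofReal (Real.exp (g z))) K ∂P ≤ 1 := by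
    intro K
    set ρ : Z → ℝ := fun z => truncRatio K (q' z) (g z) with hρ
    have hρm : AEMeasurable ρ P :=
      AEMeasurable.truncRatio K (h𝒬.measurable q' hq').aemeasurable hgi.aemeasurable
    have hρi : Integrable ρ P := by
      refine (integrable_const (K : ℝ)).mono' hρm.aestronglyMeasurable (ae_of_all _ fun z => ?_)
      rw [Real.norm_of_nonneg (truncRatio_nonneg _ _ _)]
      exact truncRatio_le _ _ _
    -- expand the logarithm to first order and let `t → 0`
    have hsmall : ∀ t : ℝ, 0 < t → t < 1 / 2 → ∫ z, ρ z ∂P - 1 ≤ t * (K + 1) ^ 2 := by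
      intro t h0 h1
      have hpt : ∀ z, t * (ρ z - 1) - t ^ 2 * (K + 1) ^ 2
          ≤ Real.log (1 + t * (ρ z - 1)) := by
        intro z
        have hz0 : 0 ≤ ρ z := truncRatio_nonneg _ _ _
        have hz1 : ρ z ≤ K := truncRatio_le _ _ _
        refine le_trans ?_ (sub_sq_le_log_one_add (by nlinarith))
        have : (ρ z - 1) ^ 2 ≤ (K + 1) ^ 2 := by
          rw [sq_le_sq, abs_of_nonneg (by linarith : (0:ℝ) ≤ K + 1), abs_le]
          constructor <;> linarith
        rw [mul_pow]
        nlinarith [sq_nonneg t]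
      have hi0 : Integrable (fun z => t * (ρ z - 1)) P :=
        (hρi.sub (integrable_const 1)).const_mul t
      have hi1 : Integrable (fun z => t * (ρ z - 1) - t ^ 2 * (K + 1) ^ 2) P :=
        hi0.sub (integrable_const _)
      have hi2 : Integrable (fun z => Real.log (1 + t * (ρ z - 1))) P :=
        integrable_log_truncRatio K h0 (by linarith) (h𝒬.measurable q' hq').aemeasurable
          hgi.aemeasurable
      have h2 := (integral_mono hi1 hi2 hpt).trans (hlog K t h0 (by linarith))
      rw [integral_sub hi0 (integrable_const _),
        integral_const_mul, integral_sub hρi (integrable_const 1)] at h2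
      simp only [integral_const, probReal_univ, one_smul] at h2
      refine le_of_mul_le_mul_left ?_ h0
      linarith
    have hle1 : ∫ z, ρ z ∂P ≤ 1 := by
      have hlim : Tendsto (fun t : ℝ => t * ((K : ℝ) + 1) ^ 2) (𝓝[>] 0) (𝓝 0) := by
        have : Tendsto (fun t : ℝ => t * ((K : ℝ) + 1) ^ 2) (𝓝 0) (𝓝 (0 * ((K : ℝ) + 1) ^ 2)) :=
          tendsto_id.mul_const _
        rw [zero_mul] at this
        exact this.mono_left nhdsWithin_le_nhds
      have : ∫ z, ρ z ∂P - 1 ≤ 0 := by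
        refine ge_of_tendsto hlim ?_
        filter_upwards [Ioo_mem_nhdsGT (by norm_num : (0 : ℝ) < 1 / 2)] with t ht
        exact hsmall t ht.1 ht.2
      linarith
    have e : ∫⁻ z, min (q' z * ENNReal.ofReal (Real.exp (g z))) K ∂P
        = ENNReal.ofReal (∫ z, ρ z ∂P) := by
      rw [ofReal_integral_eq_lintegral_ofReal hρi (ae_of_all _ fun z => truncRatio_nonneg _ _ _)]
      exact lintegral_congr fun z => (ofReal_truncRatio K _ _).symm
    rw [e]
    exact ENNReal.ofReal_le_one.2 hle1
  -- remove the truncation by Fatou's lemma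
  have hfatou := lintegral_liminf_le' (μ := P) (u := atTop)
    (f := fun (K : ℕ) z => min (q' z * ENNReal.ofReal (Real.exp (g z))) (K : ℝ≥0∞)) (fun K =>
      ((h𝒬.measurable q' hq').aemeasurable.mul
        (Real.measurable_exp.comp_aemeasurable hgi.aemeasurable).ennreal_ofReal).min
          aemeasurable_const)
  have hlim : ∀ z, liminf (fun K : ℕ => min (q' z * ENNReal.ofReal (Real.exp (g z))) (K : ℝ≥0∞)) atTop
      = q' z * ENNReal.ofReal (Real.exp (g z)) := by
    intro z
    refine Tendsto.liminf_eq ?_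
    have := Tendsto.min (tendsto_const_nhds (x := q' z * ENNReal.ofReal (Real.exp (g z))))
      ENNReal.tendsto_nat_nhds_top
    simpa using this
  simp only [hlim] at hfatou
  refine hfatou.trans ((liminf_le_liminf (Eventually.of_forall hK)).trans ?_)
  simp

end Projection

/-! ### Pseudo-comparators under the central and PPC conditions -/

section Setting

variable {Z F : Type*} [MeasurableSpace Z] [MeasurableSpace F]
  {P : Measure Z} {loss : F → Z → EReal} {fstar : F} {τ : ℝ → ℝ} {c : ℝ}
  {v : ℝ≥0 → ℝ≥0} {ε : ℝ≥0}

lemma IsLearningProblem.measurable_exp_loss (hP : IsLearningProblem P loss) (θ : ℝ) :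
    Measurable (fun p : F × Z => EReal.exp (((-θ : ℝ) : EReal) * loss p.1 p.2)) :=
  EReal.exp_monotone.measurable.comp (measurable_const.mul hP.measurable)

lemma isDistributionOn_dirac (hP : IsLearningProblem P loss) (f : F) :
    IsDistributionOn loss (Measure.dirac f) := by
  refine ⟨inferInstance, fun z => ?_⟩
  have hm : Measurable fun g => (-loss g z).toENNReal :=
    (hP.measurable.comp measurable_prodMk_right).neg.ereal_toENNReal
  rw [lintegral_dirac' _ hm]
  rw [lt_top_iff_ne_top, Ne, EReal.toENNReal_eq_top_iff]
  simpa using hP.ne_bot f z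

/-- Under the `v`-central condition, shifting the loss of `fstar` by the constant `ε` yields a
pseudo-comparator. -/
lemma VCentral.isPseudoComparator [IsProbabilityMeasure P] (hP : IsLearningProblem P loss)
    (hw : TauWitness P loss fstar τ c) (h : VCentral P loss fstar v) (hv : 0 < v ε) :
    IsPseudoComparator P loss fstar (v ε) ε (fun _ => ε) where
  measurable := measurable_const
  integrable := integrable_const _
  integral_le := by simp
  lintegral_expLoss_le f := by
    refine le_trans (le_of_eq ?_) (h ε hv f)
    refine lintegral_congr_ae ?_
    filter_upwards [hw.ae_loss_ne_top hP f, hw.ae_comparator_ne_top hP] with z hf hs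
    rw [expLoss_coe (excessLoss_eq_coe hP hs hf)]
    rw [← EReal.coe_toReal hf (hP.ne_bot _ _), ← EReal.coe_toReal hs (hP.ne_bot _ _),
      ← EReal.coe_sub, ← EReal.coe_sub, ← EReal.coe_mul, EReal.exp_coe]
    congr 2
    simp only [EReal.toReal_coe]
    ring

/-- The exponentiated mix loss `E_{f ∼ Q}[exp (-θ loss f z)]`. -/
noncomputable def expMix (loss : F → Z → EReal) (θ : ℝ) (Q : Measure F) (z : Z) : ℝ≥0∞ :=
  ∫⁻ f, EReal.exp (((-θ : ℝ) : EReal) * loss f z) ∂Q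

omit [MeasurableSpace Z] in
lemma mixLoss_le {θ : ℝ} (hθ : 0 < θ) {Q : Measure F} {z : Z} {x : ℝ}
    (h : ENNReal.ofReal (Real.exp (-x)) ≤ expMix loss θ Q z) :
    mixLoss loss θ Q z ≤ ((θ⁻¹ * x : ℝ) : EReal) := by
  have h1 : ((-x : ℝ) : EReal) ≤ ENNReal.log (expMix loss θ Q z) := by
    rw [← EReal.log_exp ((-x : ℝ) : EReal), EReal.exp_coe]
    exact ENNReal.log_le_log h
  have e : mixLoss loss θ Q z = -(((θ⁻¹ : ℝ) : EReal) * ENNReal.log (expMix loss θ Q z)) := by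
    rw [← neg_mul, ← EReal.coe_neg]; rfl
  have e2 : ((θ⁻¹ * x : ℝ) : EReal) = -(((θ⁻¹ : ℝ) : EReal) * ((-x : ℝ) : EReal)) := by
    rw [← EReal.coe_mul, ← EReal.coe_neg]; congr 1; ring
  rw [e, e2, EReal.neg_le_neg_iff]
  exact mul_le_mul_of_nonneg_left h1 (by exact_mod_cast (inv_pos.2 hθ).le)

omit [MeasurableSpace Z] in
lemma expMix_of_mixLoss_eq {θ : ℝ} (hθ : 0 < θ) {Q : Measure F} {z : Z} {x : ℝ}
    (h : mixLoss loss θ Q z = x) :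
    expMix loss θ Q z = ENNReal.ofReal (Real.exp (-(θ * x))) := by
  have hm : mixLoss loss θ Q z = ((-θ⁻¹ : ℝ) : EReal) * ENNReal.log (expMix loss θ Q z) := rfl
  rw [hm] at h
  rw [← ENNReal.exp_log (expMix loss θ Q z), ← EReal.exp_coe]
  congr 1
  rw [neg_mul_eq_neg_mul, EReal.coe_mul, ← h, ← mul_assoc, ← EReal.coe_mul,
    show -θ * -θ⁻¹ = 1 by field_simp]
  simp

lemma IsLearningProblem.measurable_expMix (hP : IsLearningProblem P loss) (θ : ℝ) (Q : Measure F)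
    [SFinite Q] : Measurable (expMix loss θ Q) :=
  (hP.measurable_exp_loss θ).lintegral_prod_left'

lemma IsLearningProblem.measurable_mixLoss (hP : IsLearningProblem P loss) (θ : ℝ) (Q : Measure F)
    [SFinite Q] : Measurable (mixLoss loss θ Q) :=
  measurable_const.mul (ENNReal.log_monotone.measurable.comp (hP.measurable_expMix θ Q))

lemma expMix_dirac (hP : IsLearningProblem P loss) (θ : ℝ) (f : F) (z : Z) :
    expMix loss θ (Measure.dirac f) z = EReal.exp (((-θ : ℝ) : EReal) * loss f z) := by
  have hm : Measurable fun g => EReal.exp (((-θ : ℝ) : EReal) * loss g z) :=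
    (hP.measurable_exp_loss θ).comp measurable_prodMk_right
  exact lintegral_dirac' _ hm

/-- The infimum in the `v`-PPC condition is finite: the condition bounds it below, and the point mass
at `fstar` bounds it above. -/
lemma VPPC.exists_iInf_eq (hP : IsLearningProblem P loss)
    (hw : TauWitness P loss fstar τ c) (h : VPPC P loss fstar v) (hv : 0 < v ε) :
    ∃ m : ℝ, (⨅ (Q : Measure F) (_ : IsDistributionOn loss Q), extExp P (mixLoss loss (v ε) Q)) = m ∧
      ∫ z, (loss fstar z).toReal ∂P - m ≤ ε := by
  have hθ : (0 : ℝ) < v ε := by exact_mod_cast hv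
  have hstar : extExp P (loss fstar) = ((∫ z, (loss fstar z).toReal ∂P : ℝ) : EReal) := by
    refine extExp_eq_integral (hw.integrable_loss hP fstar) ?_
    filter_upwards [hw.ae_comparator_ne_top hP] with z hz
    exact (EReal.coe_toReal hz (hP.ne_bot _ _)).symm
  have hle : (⨅ (Q : Measure F) (_ : IsDistributionOn loss Q), extExp P (mixLoss loss (v ε) Q))
      ≤ ((∫ z, (loss fstar z).toReal ∂P : ℝ) : EReal) := by
    refine (iInf₂_le (Measure.dirac fstar) (isDistributionOn_dirac hP fstar)).trans ?_
    rw [← hstar]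
    refine extExp_mono_ae ?_
    filter_upwards [hw.ae_comparator_ne_top hP] with z hz
    refine (mixLoss_le hθ (x := v ε * (loss fstar z).toReal) ?_).trans (le_of_eq ?_)
    · rw [expMix_dirac hP, ← EReal.coe_toReal hz (hP.ne_bot _ _), ← EReal.coe_mul, EReal.exp_coe]
      simp
    · rw [inv_mul_cancel_left₀ hθ.ne', EReal.coe_toReal hz (hP.ne_bot _ _)]
  have hppc := h ε hv
  rw [hstar] at hppc
  generalize (⨅ (Q : Measure F) (_ : IsDistributionOn loss Q), extExp P (mixLoss loss (v ε) Q)) = M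
    at hle hppc
  induction M with
  | bot => simp at hppc
  | top => simp at hle
  | coe m => exact ⟨m, rfl, by rw [← EReal.coe_sub] at hppc; exact_mod_cast hppc⟩

lemma isMixtureClass_expMix [IsProbabilityMeasure P] (hP : IsLearningProblem P loss) {θ m : ℝ}
    (hθ : 0 < θ)
    (hm : (⨅ (Q : Measure F) (_ : IsDistributionOn loss Q), extExp P (mixLoss loss θ Q)) = m) :
    IsMixtureClass P {q | ∃ Q : Measure F, IsDistributionOn loss Q ∧ q = expMix loss θ Q}
      (θ * m) where
  measurable := by
    rintro _ ⟨Q, hQ, rfl⟩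
    have := hQ.1
    exact hP.measurable_expMix θ Q
  convex := by
    rintro _ ⟨Q, hQ, rfl⟩ _ ⟨Q', hQ', rfl⟩ t h0 h1
    have := hQ.1
    have := hQ'.1
    refine ⟨ENNReal.ofReal (1 - t) • Q + ENNReal.ofReal t • Q', ⟨⟨?_⟩, fun z => ?_⟩, ?_⟩
    · simp only [Measure.add_apply, Measure.smul_apply, measure_univ, smul_eq_mul, mul_one]
      rw [← ENNReal.ofReal_add (by linarith) h0]
      simp
    · rw [lintegral_add_measure, lintegral_smul_measure, lintegral_smul_measure]
      exact ENNReal.add_lt_top.2 ⟨ENNReal.mul_lt_top ENNReal.ofReal_lt_top (hQ.2 z),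
        ENNReal.mul_lt_top ENNReal.ofReal_lt_top (hQ'.2 z)⟩
    · funext z
      unfold expMix
      rw [lintegral_add_measure, lintegral_smul_measure, lintegral_smul_measure]
      rfl
  le_integral := by
    rintro _ ⟨Q, hQ, rfl⟩ x hx hle
    have h1 : (m : EReal) ≤ extExp P (mixLoss loss θ Q) := by
      rw [← hm]; exact iInf₂_le Q hQ
    have h2 : extExp P (mixLoss loss θ Q) ≤ ((∫ z, θ⁻¹ * x z ∂P : ℝ) : EReal) := by
      rw [← extExp_coe (hx.const_mul _)]
      exact extExp_mono_ae (hle.mono fun z hz => mixLoss_le hθ hz)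
    have h3 : m ≤ ∫ z, θ⁻¹ * x z ∂P := by exact_mod_cast h1.trans h2
    rw [integral_const_mul, inv_mul_eq_div, le_div_iff₀ hθ] at h3
    linarith
  exists_lt := by
    intro γ hγ
    have hlt : (⨅ (Q : Measure F) (_ : IsDistributionOn loss Q), extExp P (mixLoss loss θ Q))
        < ((m + θ⁻¹ * γ : ℝ) : EReal) := by
      rw [hm]
      have : 0 < θ⁻¹ * γ := by positivity
      exact_mod_cast (by linarith : m < m + θ⁻¹ * γ)
    simp only [iInf_lt_iff] at hlt
    obtain ⟨Q, hQ, hlt⟩ := hlt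
    have := hQ.1
    have hge : (m : EReal) ≤ extExp P (mixLoss loss θ Q) := by rw [← hm]; exact iInf₂_le Q hQ
    obtain ⟨r, hr⟩ : ∃ r : ℝ, extExp P (mixLoss loss θ Q) = r := by
      generalize extExp P (mixLoss loss θ Q) = M at hge hlt
      induction M with
      | bot => simp at hge
      | top => simp at hlt
      | coe r => exact ⟨r, rfl⟩
    obtain ⟨hfin, hint, heq⟩ :=
      integrable_of_extExp_eq_coe (hP.measurable_mixLoss θ Q).aemeasurable hr
    refine ⟨_, ⟨Q, hQ, rfl⟩, fun z => θ * (mixLoss loss θ Q z).toReal, hint.const_mul θ,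
      hfin.mono fun z hz => expMix_of_mixLoss_eq hθ hz, ?_⟩
    rw [integral_const_mul, heq]
    rw [hr] at hlt
    have hlt' : r < m + θ⁻¹ * γ := by exact_mod_cast hlt
    calc θ * r < θ * (m + θ⁻¹ * γ) := by gcongr
      _ = _ := by field_simp

/-- Under the `v`-PPC condition, the reverse information projection onto the exponentiated mix losses
is a pseudo-comparator. -/
lemma VPPC.exists_isPseudoComparator [IsProbabilityMeasure P] (hP : IsLearningProblem P loss)
    (hw : TauWitness P loss fstar τ c) (h : VPPC P loss fstar v) (hv : 0 < v ε) :
    ∃ Y, IsPseudoComparator P loss fstar (v ε) ε Y := by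
  have hθ : (0 : ℝ) < v ε := by exact_mod_cast hv
  obtain ⟨m, hm, hle⟩ := h.exists_iInf_eq hP hw hv
  set θ : ℝ := ((v ε : ℝ≥0) : ℝ)
  obtain ⟨g, hgm, hgi, hgint, hg⟩ := (isMixtureClass_expMix hP hθ hm).exists_projection
  have hYi := (hw.integrable_loss hP fstar).sub (hgi.const_mul θ⁻¹)
  refine ⟨fun z => (loss fstar z).toReal - θ⁻¹ * g z, ?_, hYi, ?_, fun f => ?_⟩
  · exact (hP.measurable_loss fstar).ereal_toReal.sub (hgm.const_mul _)
  · rw [integral_sub (hw.integrable_loss hP fstar) (hgi.const_mul θ⁻¹), integral_const_mul, hgint,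
      inv_mul_cancel_left₀ hθ.ne']
    exact hle
  · refine le_trans (le_of_eq ?_) (hg _ ⟨Measure.dirac f, isDistributionOn_dirac hP f, rfl⟩)
    refine lintegral_congr_ae ?_
    filter_upwards [hw.ae_loss_ne_top hP f, hw.ae_comparator_ne_top hP] with z hf hs
    rw [expLoss_coe (excessLoss_eq_coe hP hs hf), expMix_dirac hP,
      ← EReal.coe_toReal hf (hP.ne_bot _ _), ← EReal.coe_mul, EReal.exp_coe,
      ← ENNReal.ofReal_mul (Real.exp_pos _).le, ← Real.exp_add]
    congr 2
    simp only [EReal.toReal_coe]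
    field_simp
    ring

end Setting

/-! ### Bounds for the excess risk at a fixed sample size -/

/-- Markov's inequality in a form that also covers the bound `s = 0`, for which `h` vanishes a.e. -/
lemma measureReal_mul_le_inter_pos_le {Ω : Type*} [MeasurableSpace Ω] {ν : Measure Ω}
    [IsProbabilityMeasure ν] {h : Ω → ℝ} (hi : Integrable h ν) (hnn : ∀ ω, 0 ≤ h ω) {s K : ℝ}
    (hs : ∫ ω, h ω ∂ν ≤ s) (hK : 0 < K) :
    ν.real {ω | K * s ≤ h ω ∧ 0 < h ω} ≤ 1 / K := by
  have hH : 0 ≤ ∫ ω, h ω ∂ν := integral_nonneg hnn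
  rcases (hH.trans hs).eq_or_lt with rfl | hs0
  · have h0 : ∫ ω, h ω ∂ν = 0 := le_antisymm hs hH
    have h1 : h =ᵐ[ν] 0 := (integral_eq_zero_iff_of_nonneg hnn hi).1 h0
    have h2 : ν {ω | K * 0 ≤ h ω ∧ 0 < h ω} = 0 :=
      measure_mono_null (fun ω hω => (hω.2.ne' : h ω ≠ 0)) h1
    rw [measureReal_def, h2]
    simp [hK.le]
  · have hKs : 0 < K * s := by positivity
    calc _ ≤ ν.real {ω | K * s ≤ h ω} := measureReal_mono fun ω hω => hω.1
      _ ≤ (∫ ω, h ω ∂ν) / (K * s) := by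
        rw [le_div_iff₀ hKs, mul_comm]
        exact mul_meas_ge_le_integral_of_nonneg (ae_of_all _ hnn) hi _
      _ ≤ s / (K * s) := by gcongr
      _ = 1 / K := by field_simp

/-- The set `s` need not be measurable. -/
lemma one_sub_le_measureReal {Ω : Type*} [MeasurableSpace Ω] {μ : Measure Ω}
    [IsProbabilityMeasure μ] {s : Set Ω} {δ : ℝ} (h : μ.real sᶜ ≤ δ) : 1 - δ ≤ μ.real s := by
  have h1 := measureReal_union_le (μ := μ) s sᶜ
  rw [Set.union_compl_self, probReal_univ] at h1
  linarith

section Setting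

variable {Z F : Type*} [MeasurableSpace Z] [MeasurableSpace F]
  {P : Measure Z} {loss : F → Z → EReal} {fstar : F} {τ : ℝ → ℝ} {c : ℝ}
  {Y : Z → ℝ} {η θ ε : ℝ}

instance [IsProbabilityMeasure P] (n : ℕ) : IsProbabilityMeasure (sampleLaw P n) := by
  unfold sampleLaw; infer_instance

lemma measurePreserving_eval_sampleLaw [IsProbabilityMeasure P] {n : ℕ} (i : Fin n) :
    MeasurePreserving (Function.eval i) (sampleLaw P n) P :=
  measurePreserving_eval (fun _ : Fin n => P) i

lemma TauWitness.ae_sample_comparator_ne_top [IsProbabilityMeasure P] (hP : IsLearningProblem P loss)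
    (hw : TauWitness P loss fstar τ c) (n : ℕ) :
    ∀ᵐ z ∂(sampleLaw P n), ∀ i, loss fstar (z i) ≠ ⊤ :=
  ae_all_iff.2 fun i =>
    (measurePreserving_eval_sampleLaw i).quasiMeasurePreserving.ae (hw.ae_comparator_ne_top hP)

variable {prior : Measure F} {post : (n : ℕ) → (Fin n → Z) → Measure F} {n : ℕ}

/-- The law of the random predictor `f ∼ post n (Z₁, …, Zₙ)`, averaged over the sample. -/
noncomputable def predictorLaw (P : Measure Z) (post : (n : ℕ) → (Fin n → Z) → Measure F) (n : ℕ) :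
    Measure F :=
  (sampleLaw P n).bind (post n)

lemma isProbabilityMeasure_predictorLaw [IsProbabilityMeasure P] (hpost : Measurable (post n))
    (hQ : ∀ z, IsDistributionOn loss (post n z)) :
    IsProbabilityMeasure (predictorLaw P post n) := by
  refine ⟨?_⟩
  unfold predictorLaw
  rw [Measure.bind_apply MeasurableSet.univ hpost.aemeasurable]
  have : ∀ z, post n z Set.univ = 1 := fun z => (hQ z).1.measure_univ
  simp [this]

lemma IsPseudoComparator.integrable_hellDiv [IsProbabilityMeasure P] (hP : IsLearningProblem P loss)
    (hw : TauWitness P loss fstar τ c)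
    (hY : IsPseudoComparator P loss fstar θ ε Y) (hη : 0 < η) (hηθ : η ≤ θ)
    (Q : Measure F) [IsFiniteMeasure Q] :
    Integrable (hellDiv P loss fstar Y η) Q := by
  refine (integrable_const (1 / η)).mono' (measurable_hellDiv hP hY.measurable).aestronglyMeasurable
    (ae_of_all _ fun f => ?_)
  rw [Real.norm_of_nonneg (hY.hellDiv_nonneg hP hw hη hηθ f)]
  exact hellDiv_le_inv hη f

/-- The information complexity bound in expectation. It also shows that `E[IC]` is never `⊥`. -/
lemma IsPseudoComparator.integral_hellDiv_sub_le [IsProbabilityMeasure P]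
    (hP : IsLearningProblem P loss) (hw : TauWitness P loss fstar τ c)
    (hY : IsPseudoComparator P loss fstar θ ε Y) (hη : 0 < η) (hηθ : η ≤ θ) (hn : 1 ≤ n)
    [IsProbabilityMeasure prior] (hpost : Measurable (post n))
    (hQ : ∀ z, IsDistributionOn loss (post n z)) :
    ((∫ f, hellDiv P loss fstar Y η f ∂(predictorLaw P post n) - ε : ℝ) : EReal)
      ≤ extExp (sampleLaw P n) (infoComplexity loss fstar prior post η n) := by
  have hn0 : (0 : ℝ) < n := by exact_mod_cast hn
  have hηn : 0 < η * n := by positivity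
  set h := hellDiv P loss fstar Y η with hh
  have hnn : ∀ f, 0 ≤ h f := hY.hellDiv_nonneg hP hw hη hηθ
  have hhm : Measurable h := measurable_hellDiv hP hY.measurable
  have hprob : ∀ z, IsProbabilityMeasure (post n z) := fun z => (hQ z).1
  have := isProbabilityMeasure_predictorLaw (P := P) hpost hQ
  set G := priorMGF P loss fstar prior Y η n with hG
  have hGm : Measurable G := measurable_priorMGF hP hY.measurable n prior
  have hG1 : ∫⁻ z, G z ∂(sampleLaw P n) ≤ 1 := hY.lintegral_priorMGF_le hP hw hη hηθ prior n
  have hGtop : ∀ᵐ z ∂(sampleLaw P n), G z < ∞ :=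
    ae_lt_top hGm (hG1.trans_lt ENNReal.one_lt_top).ne
  have hGi : Integrable (fun z => (G z).toReal) (sampleLaw P n) :=
    integrable_toReal_of_lintegral_ne_top hGm.aemeasurable (hG1.trans_lt ENNReal.one_lt_top).ne
  have hGint : ∫ z, (G z).toReal ∂(sampleLaw P n) ≤ 1 := by
    rw [integral_toReal hGm.aemeasurable hGtop]
    exact ENNReal.toReal_le_of_le_ofReal zero_le_one (by simpa using hG1)
  have hYi : ∀ i : Fin n, Integrable (fun z : Fin n → Z => Y (z i)) (sampleLaw P n) := fun i =>
    (measurePreserving_eval_sampleLaw i).integrable_comp_of_integrable hY.integrable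
  have hYint : ∀ i : Fin n, ∫ z : Fin n → Z, Y (z i) ∂(sampleLaw P n) = ∫ z, Y z ∂P := fun i => by
    have := integral_map (μ := sampleLaw P n) (f := Y)
      (measurePreserving_eval_sampleLaw (P := P) i).measurable.aemeasurable
      hY.measurable.aestronglyMeasurable
    rw [(measurePreserving_eval_sampleLaw (P := P) i).map_eq] at this
    exact this.symm
  have hYbi : Integrable (fun z : Fin n → Z => (n : ℝ)⁻¹ * ∑ i, Y (z i)) (sampleLaw P n) :=
    (integrable_finsetSum _ fun i _ => hYi i).const_mul _
  have hYbint : ∫ z : Fin n → Z, (n : ℝ)⁻¹ * ∑ i, Y (z i) ∂(sampleLaw P n) ≤ ε := by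
    rw [integral_const_mul, integral_finsetSum _ fun i _ => hYi i]
    simp only [hYint, Finset.sum_const, Finset.card_univ, Fintype.card_fin, nsmul_eq_mul]
    rw [inv_mul_cancel_left₀ hn0.ne']
    exact hY.integral_le
  -- the posterior mean of the divergence, as a function of the sample
  have hlm : Measurable fun z => ∫⁻ f, ENNReal.ofReal (h f) ∂(post n z) :=
    (Measure.measurable_lintegral hhm.ennreal_ofReal).comp hpost
  have hAe : ∀ z, ∫ f, h f ∂(post n z) = (∫⁻ f, ENNReal.ofReal (h f) ∂(post n z)).toReal := fun z =>
    integral_eq_lintegral_of_nonneg_ae (ae_of_all _ hnn) hhm.aestronglyMeasurable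
  have hlb : ∫⁻ z, ∫⁻ f, ENNReal.ofReal (h f) ∂(post n z) ∂(sampleLaw P n)
      = ∫⁻ f, ENNReal.ofReal (h f) ∂(predictorLaw P post n) :=
    (Measure.lintegral_bind hpost.aemeasurable hhm.ennreal_ofReal.aemeasurable).symm
  have hlt : ∫⁻ f, ENNReal.ofReal (h f) ∂(predictorLaw P post n) ≠ ∞ :=
    (hY.integrable_hellDiv hP hw hη hηθ _).lintegral_lt_top.ne
  have hAi : Integrable (fun z => ∫ f, h f ∂(post n z)) (sampleLaw P n) := by
    simp only [hAe]
    exact integrable_toReal_of_lintegral_ne_top hlm.aemeasurable (by rw [hlb]; exact hlt)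
  have hAint : ∫ z, ∫ f, h f ∂(post n z) ∂(sampleLaw P n) = ∫ f, h f ∂(predictorLaw P post n) := by
    simp only [hAe]
    rw [integral_toReal hlm.aemeasurable (ae_lt_top hlm (by rw [hlb]; exact hlt)), hlb,
      integral_eq_lintegral_of_nonneg_ae (ae_of_all _ hnn) hhm.aestronglyMeasurable]
  have hRi : Integrable (fun z => (1 - (G z).toReal) / (η * n)) (sampleLaw P n) :=
    ((integrable_const 1).sub hGi).div_const _
  have hABi : Integrable (fun z => ∫ f, h f ∂(post n z) - (n : ℝ)⁻¹ * ∑ i, Y (z i))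
    (sampleLaw P n) := hAi.sub hYbi
  refine le_trans ?_ (integral_le_extExp (x := fun z => ∫ f, h f ∂(post n z)
    - (n : ℝ)⁻¹ * ∑ i, Y (z i) + (1 - (G z).toReal) / (η * n)) (hABi.add hRi) ?_)
  · rw [EReal.coe_le_coe_iff, integral_add hABi hRi, integral_sub hAi hYbi, hAint, integral_div,
      integral_sub (integrable_const 1) hGi]
    have : 0 ≤ (∫ _ : Fin n → Z, (1 : ℝ) ∂(sampleLaw P n) - ∫ z, (G z).toReal ∂(sampleLaw P n))
        / (η * n) := by
      refine div_nonneg ?_ hηn.le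
      simp only [integral_const, probReal_univ, one_smul]
      linarith
    linarith
  · filter_upwards [hw.ae_sample_comparator_ne_top hP n, hGtop] with z hz hGz
    have := le_infoComplexity hP hn hη hY.measurable hnn (prior := prior) (hQ z) hz hGz.ne 0
    simpa using this

/-- The information complexity bound in probability. -/
lemma IsPseudoComparator.measure_not_le_infoComplexity [IsProbabilityMeasure P]
    (hP : IsLearningProblem P loss) (hw : TauWitness P loss fstar τ c)
    (hY : IsPseudoComparator P loss fstar θ ε Y) (hη : 0 < η) (hηθ : η ≤ θ) (hn : 1 ≤ n)
    [IsProbabilityMeasure prior] (hQ : ∀ z, IsDistributionOn loss (post n z)) (t : ℝ) :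
    (sampleLaw P n).real {z | ¬ (((∫ f, hellDiv P loss fstar Y η f ∂(post n z)
      - (n : ℝ)⁻¹ * ∑ i, Y (z i) - t / (η * n) : ℝ) : EReal)
        ≤ infoComplexity loss fstar prior post η n z)} ≤ Real.exp (-t) := by
  have hn0 : (0 : ℝ) < n := by exact_mod_cast hn
  have hηn : 0 < η * n := by positivity
  have hnn := hY.hellDiv_nonneg hP hw hη hηθ
  set G := priorMGF P loss fstar prior Y η n with hG
  have hGm : Measurable G := measurable_priorMGF hP hY.measurable n prior
  have hG1 : ∫⁻ z, G z ∂(sampleLaw P n) ≤ 1 := hY.lintegral_priorMGF_le hP hw hη hηθ prior n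
  have hsub : ∀ᵐ z ∂(sampleLaw P n), (¬ (((∫ f, hellDiv P loss fstar Y η f ∂(post n z)
      - (n : ℝ)⁻¹ * ∑ i, Y (z i) - t / (η * n) : ℝ) : EReal)
        ≤ infoComplexity loss fstar prior post η n z)) →
      ENNReal.ofReal (Real.exp t) ≤ G z := by
    filter_upwards [hw.ae_sample_comparator_ne_top hP n] with z hz hbad
    by_contra hlt
    rw [not_le] at hlt
    refine hbad (le_trans ?_ (le_infoComplexity hP hn hη hY.measurable hnn (prior := prior) (hQ z)
      hz hlt.ne_top t))
    rw [EReal.coe_le_coe_iff]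
    have h1 : (G z).toReal ≤ Real.exp t := ENNReal.toReal_le_of_le_ofReal (Real.exp_pos _).le hlt.le
    have h2 : Real.exp (-t) * (G z).toReal ≤ 1 := by
      calc _ ≤ Real.exp (-t) * Real.exp t := by gcongr
        _ = 1 := by rw [← Real.exp_add]; simp
    have h3 : -t / (η * n) ≤ (1 - t - Real.exp (-t) * (G z).toReal) / (η * n) := by
      gcongr ?_ / _; linarith
    rw [neg_div] at h3
    linarith
  refine ENNReal.toReal_le_of_le_ofReal (Real.exp_pos _).le ((measure_mono_ae hsub).trans ?_)
  refine (meas_ge_le_lintegral_div hGm.aemeasurable (by simp [Real.exp_pos])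
    ENNReal.ofReal_ne_top).trans ?_
  rw [Real.exp_neg, ENNReal.ofReal_inv_of_pos (Real.exp_pos t), ← one_div]
  gcongr

/-- A divergence strictly below `s` rules out the clipping at `1` in `min_excessRisk_le`, even for
`factorC₂ u c η θ * s = 1`. -/
lemma IsPseudoComparator.excessRisk_le [IsProbabilityMeasure P] (hP : IsLearningProblem P loss)
    {u : ℝ} (hu : 1 ≤ u) (hc : 0 < c)
    (hw : TauWitness P loss fstar (fun x => u * max 1 x) c)
    (hY : IsPseudoComparator P loss fstar θ ε Y) (hη : 0 < η) (hηθ : 2 * η < θ) (f : F) {s : ℝ}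
    (hs0 : 0 ≤ s) (hs : hellDiv P loss fstar Y η f < s ∨ hellDiv P loss fstar Y η f ≤ 0)
    (h1 : factorC₂ u c η θ * s ≤ 1) :
    excessRisk P loss fstar f ≤ ((factorC₂ u c η θ * s : ℝ) : EReal) := by
  obtain ⟨r, hr, -⟩ := hw f
  have hC := factorC₂_pos hu hc hη hηθ
  have key := hY.min_excessRisk_le hP hu hc hw hη hηθ f hr
  rw [hr, EReal.coe_le_coe_iff]
  have h0 : 0 ≤ factorC₂ u c η θ * s := by positivity
  have : min r 1 < 1 ∧ min r 1 ≤ factorC₂ u c η θ * s := by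
    rcases hs with hs | hs
    · have : factorC₂ u c η θ * hellDiv P loss fstar Y η f < factorC₂ u c η θ * s := by gcongr
      constructor <;> linarith
    · have : factorC₂ u c η θ * hellDiv P loss fstar Y η f ≤ 0 :=
        mul_nonpos_of_nonneg_of_nonpos hC.le hs
      constructor <;> linarith
  rcases le_total r 1 with h | h
  · rw [min_eq_left h] at this; exact this.2
  · rw [min_eq_right h] at this; exact absurd this.1 (lt_irrefl _)

lemma IsPseudoComparator.lt_hellDiv_or [IsProbabilityMeasure P] (hP : IsLearningProblem P loss)
    {u : ℝ} (hu : 1 ≤ u) (hc : 0 < c)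
    (hw : TauWitness P loss fstar (fun x => u * max 1 x) c)
    (hY : IsPseudoComparator P loss fstar θ ε Y) (hη : 0 < η) (hηθ : 2 * η < θ) {f : F} {s : ℝ}
    (hf : ((factorC₂ u c η θ * s : ℝ) : EReal) < excessRisk P loss fstar f) :
    s < hellDiv P loss fstar Y η f ∨ 1 ≤ factorC₂ u c η θ * hellDiv P loss fstar Y η f := by
  obtain ⟨r, hr, -⟩ := hw f
  have hC := factorC₂_pos hu hc hη hηθ
  have key := hY.min_excessRisk_le hP hu hc hw hη hηθ f hr
  rw [hr, EReal.coe_lt_coe_iff] at hf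
  rcases le_total r 1 with h | h
  · rw [min_eq_left h] at key
    exact Or.inl (lt_of_mul_lt_mul_left (hf.trans_le key) hC.le)
  · rw [min_eq_right h] at key; exact Or.inr key

/-- The posterior mass of a large excess risk is small: the two alternatives of `lt_hellDiv_or` cost
`1 / K` and `factorC₂ u c η θ * s` on average, by Markov's inequality. -/
lemma IsPseudoComparator.predictorLaw_excessRisk_le [IsProbabilityMeasure P]
    (hP : IsLearningProblem P loss) {u : ℝ} (hu : 1 ≤ u) (hc : 0 < c)
    (hw : TauWitness P loss fstar (fun x => u * max 1 x) c)
    (hY : IsPseudoComparator P loss fstar θ ε Y) (hη : 0 < η) (hηθ : 2 * η < θ)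
    (hpost : Measurable (post n)) (hQ : ∀ z, IsDistributionOn loss (post n z)) {s K B : ℝ}
    (hs : ∫ f, hellDiv P loss fstar Y η f ∂(predictorLaw P post n) ≤ s) (hK : 0 < K) (hB : 0 < B)
    {T : EReal} (hT : ((factorC₂ u c η θ * (K * s) : ℝ) : EReal) ≤ T) :
    sampleLaw P n {z | ENNReal.ofReal B < post n z {f | T < excessRisk P loss fstar f}}
      ≤ ENNReal.ofReal ((1 / K + factorC₂ u c η θ * s) / B) := by
  set C := factorC₂ u c η θ with hCdef
  have hC : 0 < C := factorC₂_pos hu hc hη hηθ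
  set h := hellDiv P loss fstar Y η with hh
  have hnn : ∀ f, 0 ≤ h f := hY.hellDiv_nonneg hP hw hη (by linarith)
  have hhm : Measurable h := measurable_hellDiv hP hY.measurable
  have := isProbabilityMeasure_predictorLaw (P := P) hpost hQ
  have hhi : Integrable h (predictorLaw P post n) := hY.integrable_hellDiv hP hw hη (by linarith) _
  set S : Set F := {f | K * s ≤ h f ∧ 0 < h f} ∪ {f | C⁻¹ ≤ h f} with hS
  have hSm : MeasurableSet S :=
    ((measurableSet_le measurable_const hhm).inter (measurableSet_lt measurable_const hhm)).union
      (measurableSet_le measurable_const hhm)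
  have hH0 : 0 ≤ ∫ f, h f ∂(predictorLaw P post n) := integral_nonneg hnn
  have hsub : {f | T < excessRisk P loss fstar f} ⊆ S := by
    intro f hf
    rcases hY.lt_hellDiv_or hP hu hc hw hη hηθ (hT.trans_lt hf) with h1 | h1
    · exact Or.inl ⟨h1.le, (by have := hH0.trans hs; positivity : 0 ≤ K * s).trans_lt h1⟩
    · refine Or.inr ?_
      change C⁻¹ ≤ h f
      rw [inv_le_iff_one_le_mul₀' hC]
      exact h1
  have hSle : (predictorLaw P post n).real S ≤ 1 / K + C * s := by
    refine (measureReal_union_le _ _).trans (add_le_add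
      (measureReal_mul_le_inter_pos_le hhi hnn hs hK) ?_)
    have := mul_meas_ge_le_integral_of_nonneg (ae_of_all _ hnn) hhi C⁻¹
    rw [inv_mul_le_iff₀ hC] at this
    exact this.trans (by gcongr)
  have hbind : ∫⁻ z, post n z S ∂(sampleLaw P n) = predictorLaw P post n S :=
    (Measure.bind_apply hSm hpost.aemeasurable).symm
  have hmS : Measurable fun z => post n z S := (Measure.measurable_coe hSm).comp hpost
  calc _ ≤ sampleLaw P n {z | ENNReal.ofReal B ≤ post n z S} :=
        measure_mono fun z hz => (le_of_lt hz).trans (measure_mono hsub)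
    _ ≤ (∫⁻ z, post n z S ∂(sampleLaw P n)) / ENNReal.ofReal B :=
        meas_ge_le_lintegral_div hmS.aemeasurable (by simpa using hB) ENNReal.ofReal_ne_top
    _ = ENNReal.ofReal ((predictorLaw P post n).real S / B) := by
        rw [hbind, ENNReal.ofReal_div_of_pos hB, ofReal_measureReal]
    _ ≤ _ := by gcongr

end Setting

/-! ### Deterministic and randomized algorithms -/

section Setting

variable {Z F : Type*} [MeasurableSpace Z] [MeasurableSpace F]
  {P : Measure Z} {loss : F → Z → EReal} {fstar : F} {c u : ℝ}
  {Y : Z → ℝ} {η θ ε : ℝ} {prior : Measure F} {n : ℕ}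

/-- Any upper bound `E < ⊤` of `E[IC]` is a real number, and controls the mean divergence. -/
lemma IsPseudoComparator.exists_eq_coe_of_extExp_infoComplexity_le {post : (n : ℕ) → (Fin n → Z) → Measure F}
    [IsProbabilityMeasure P]
    (hP : IsLearningProblem P loss) {τ : ℝ → ℝ} (hw : TauWitness P loss fstar τ c)
    (hY : IsPseudoComparator P loss fstar θ ε Y) (hη : 0 < η) (hηθ : η ≤ θ) (hn : 1 ≤ n)
    [IsProbabilityMeasure prior] (hpost : Measurable (post n))
    (hQ : ∀ z, IsDistributionOn loss (post n z)) {E : EReal}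
    (hE : extExp (sampleLaw P n) (infoComplexity loss fstar prior post η n) ≤ E)
    (htop : E ≠ ⊤) :
    ∃ e : ℝ, E = e ∧
      ∫ f, hellDiv P loss fstar Y η f ∂(predictorLaw P post n) ≤ e + ε := by
  have key := (hY.integral_hellDiv_sub_le hP hw hη hηθ hn (prior := prior) hpost hQ).trans hE
  induction E with
  | bot => exact absurd (le_bot_iff.1 key) (EReal.coe_ne_bot _)
  | top => exact absurd rfl htop
  | coe e => exact ⟨e, rfl, by rw [EReal.coe_le_coe_iff] at key; linarith⟩

lemma measurable_pointPost {fhat : (n : ℕ) → (Fin n → Z) → F} (h : Measurable (fhat n)) :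
    Measurable (pointPost fhat n) :=
  Measure.measurable_dirac.comp h

lemma predictorLaw_pointPost {fhat : (n : ℕ) → (Fin n → Z) → F} (h : Measurable (fhat n)) :
    predictorLaw P (pointPost fhat) n = (sampleLaw P n).map (fhat n) :=
  Measure.bind_dirac_eq_map _ h

lemma ne_top_of_mul_le_one {a : ℝ} (ha : 0 < a) {x : EReal} (h : (a : EReal) * x ≤ 1) : x ≠ ⊤ := by
  rintro rfl
  rw [EReal.coe_mul_top_of_pos ha] at h
  exact EReal.coe_ne_top 1 (top_le_iff.1 h)

/-- The excess risk bound for a deterministic estimator by Markov's inequality. -/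
lemma IsPseudoComparator.one_sub_le_measureReal_excessRisk [IsProbabilityMeasure P]
    (hP : IsLearningProblem P loss) (hu : 1 ≤ u) (hc : 0 < c)
    (hw : TauWitness P loss fstar (fun x => u * max 1 x) c)
    (hY : IsPseudoComparator P loss fstar θ ε Y) (hη : 0 < η) (hηθ : 2 * η < θ) (hn : 1 ≤ n)
    [IsProbabilityMeasure prior] {fhat : (n : ℕ) → (Fin n → Z) → F} (hf : Measurable (fhat n))
    {δ : ℝ} (hδ : 0 < δ)
    (h1 : ((factorC₂ u c η θ * (1 / δ) : ℝ) : EReal) * (extExp (sampleLaw P n)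
      (infoComplexity loss fstar prior (pointPost fhat) η n) + (ε : EReal)) ≤ 1) :
    1 - δ ≤ (sampleLaw P n).real {z | excessRisk P loss fstar (fhat n z) ≤
      ((factorC₂ u c η θ * (1 / δ) : ℝ) : EReal) * (extExp (sampleLaw P n)
        (infoComplexity loss fstar prior (pointPost fhat) η n) + (ε : EReal))} := by
  have hC := factorC₂_pos hu hc hη hηθ
  have htop : extExp (sampleLaw P n) (infoComplexity loss fstar prior (pointPost fhat) η n) ≠ ⊤ := by
    intro h
    rw [h, EReal.top_add_coe] at h1
    exact ne_top_of_mul_le_one (by positivity) h1 rfl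
  obtain ⟨e, he, hH⟩ := hY.exists_eq_coe_of_extExp_infoComplexity_le hP hw hη (by linarith) hn (prior := prior)
    (measurable_pointPost hf) (fun z => isDistributionOn_dirac hP _) le_rfl htop
  have hnn := hY.hellDiv_nonneg hP hw hη (by linarith)
  have hhm := measurable_hellDiv (fstar := fstar) (η := η) hP hY.measurable
  have e0 : ((factorC₂ u c η θ * (1 / δ) : ℝ) : EReal) * ((e : EReal) + (ε : EReal))
      = ((factorC₂ u c η θ * (1 / δ * (e + ε)) : ℝ) : EReal) := by
    rw [← EReal.coe_add, ← EReal.coe_mul]; congr 1; ring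
  rw [he, e0] at h1 ⊢
  have h1' : factorC₂ u c η θ * (1 / δ * (e + ε)) ≤ 1 := by exact_mod_cast h1
  rw [predictorLaw_pointPost hf, integral_map hf.aemeasurable hhm.aestronglyMeasurable] at hH
  have hi : Integrable (fun z => hellDiv P loss fstar Y η (fhat n z)) (sampleLaw P n) := by
    have := Measure.isProbabilityMeasure_map (μ := sampleLaw P n) hf.aemeasurable
    exact (hY.integrable_hellDiv hP hw hη (by linarith) ((sampleLaw P n).map (fhat n))).comp_measurable
      hf
  have hs0 : 0 ≤ e + ε := (integral_nonneg fun z => hnn _).trans hH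
  have hmk := measureReal_mul_le_inter_pos_le hi (fun z => hnn _) hH (one_div_pos.2 hδ)
  rw [one_div_one_div] at hmk
  refine one_sub_le_measureReal (le_trans (measureReal_mono fun z hz => ?_) hmk)
  by_contra hz'
  refine hz (hY.excessRisk_le hP hu hc hw hη hηθ _ (by positivity) ?_ h1')
  by_contra hcon
  push Not at hcon
  exact hz' ⟨hcon.1, hcon.2⟩

/-- The excess risk bound for a deterministic estimator and a constant pseudo-comparator. Here the
empirical mean of `Y` does not fluctuate, so that the tail bound for the information complexity
applies. -/
lemma IsPseudoComparator.one_sub_le_measureReal_excessRisk_of_const [IsProbabilityMeasure P]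
    (hP : IsLearningProblem P loss) (hu : 1 ≤ u) (hc : 0 < c)
    (hw : TauWitness P loss fstar (fun x => u * max 1 x) c)
    (hY : IsPseudoComparator P loss fstar θ ε (fun _ => ε)) (hε : 0 ≤ ε)
    (hη : 0 < η) (hηθ : 2 * η < θ) (hn : 1 ≤ n)
    [IsProbabilityMeasure prior] {fhat : (n : ℕ) → (Fin n → Z) → F} (hf : Measurable (fhat n))
    {ICbar : (Fin n → Z) → EReal}
    (hIC : ∀ᵐ z ∂(sampleLaw P n),
      infoComplexity loss fstar prior (pointPost fhat) η n z ≤ ICbar z)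
    {δ C : ℝ} (hδ : 0 < δ) (hδ1 : δ < 1) (hC : 2 * Real.log (2 / δ) < C)
    (hbad : (sampleLaw P n).real {z | (C : EReal) * extExp (sampleLaw P n) ICbar ≤ ICbar z} ≤ δ / 2)
    (h1 : ((factorC₂ u c η θ * C : ℝ) : EReal) * (extExp (sampleLaw P n) ICbar + (ε : EReal)
      + ((1 / (n * η) : ℝ) : EReal)) ≤ 1) :
    1 - δ ≤ (sampleLaw P n).real {z | excessRisk P loss fstar (fhat n z) ≤
      ((factorC₂ u c η θ * C : ℝ) : EReal) * (extExp (sampleLaw P n) ICbar + (ε : EReal)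
        + ((1 / (n * η) : ℝ) : EReal))} := by
  have hn0 : (0 : ℝ) < n := by exact_mod_cast hn
  have hηn : 0 < η * n := by positivity
  have hC2 := factorC₂_pos hu hc hη hηθ
  set t := Real.log (2 / δ) with ht
  have ht2 : Real.log 2 ≤ t := by
    rw [ht]
    refine Real.log_le_log (by norm_num) ?_
    rw [le_div_iff₀ hδ]; linarith
  -- `2 log (2 / δ) > 2 log 2 > 1`
  have hC1 : 1 < C := by linarith [Real.log_two_gt_d9]
  have htop : extExp (sampleLaw P n) ICbar ≠ ⊤ := by
    intro h
    rw [h, EReal.top_add_coe, EReal.top_add_coe] at h1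
    exact ne_top_of_mul_le_one (by positivity) h1 rfl
  obtain ⟨e, he, hH⟩ := hY.exists_eq_coe_of_extExp_infoComplexity_le hP hw hη (by linarith) hn (prior := prior)
    (measurable_pointPost hf) (fun z => isDistributionOn_dirac hP _) (extExp_mono_ae hIC) htop
  have hnn := hY.hellDiv_nonneg hP hw hη (by linarith)
  have hs0 : 0 ≤ e + ε := (integral_nonneg hnn).trans hH
  have e0 : ((factorC₂ u c η θ * C : ℝ) : EReal) * ((e : EReal) + (ε : EReal)
      + ((1 / (n * η) : ℝ) : EReal))
      = ((factorC₂ u c η θ * (C * (e + ε + 1 / (n * η))) : ℝ) : EReal) := by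
    rw [← EReal.coe_add, ← EReal.coe_add, ← EReal.coe_mul]; congr 1; ring
  rw [he] at hbad
  rw [he, e0] at h1 ⊢
  have h1' : factorC₂ u c η θ * (C * (e + ε + 1 / (n * η))) ≤ 1 := by exact_mod_cast h1
  have htail := hY.measure_not_le_infoComplexity hP hw hη (by linarith) hn (prior := prior)
    (post := pointPost fhat) (fun z => isDistributionOn_dirac hP _) t
  have het : Real.exp (-t) = δ / 2 := by
    rw [Real.exp_neg, ht, Real.exp_log (by positivity), inv_div]
  rw [het] at htail
  have hhm := measurable_hellDiv (fstar := fstar) (η := η) hP hY.measurable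
  -- The bound can fail only on the exceptional sets `A` and `B` of mass `δ / 2` each and the null
  -- set `N`.
  set A := {z | ¬ (((∫ f, hellDiv P loss fstar (fun _ => ε) η f ∂(pointPost fhat n z)
      - (n : ℝ)⁻¹ * ∑ _i : Fin n, ε - t / (η * n) : ℝ) : EReal)
        ≤ infoComplexity loss fstar prior (pointPost fhat) η n z)} with hA
  set B := {z | (C : EReal) * (e : EReal) ≤ ICbar z} with hB
  set N := {z | ¬ (infoComplexity loss fstar prior (pointPost fhat) η n z ≤ ICbar z)} with hN
  have hNz : (sampleLaw P n).real N = 0 := by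
    rw [measureReal_def, show sampleLaw P n N = 0 from hIC]; rfl
  have hU : (sampleLaw P n).real (A ∪ B ∪ N) ≤ δ := by
    have a1 := measureReal_union_le (μ := sampleLaw P n) (A ∪ B) N
    have a2 := measureReal_union_le (μ := sampleLaw P n) A B
    linarith
  refine one_sub_le_measureReal (le_trans (measureReal_mono fun z hz => ?_) hU)
  by_contra hz'
  simp only [Set.mem_union, not_or] at hz'
  obtain ⟨⟨hzA, hzB⟩, hzN⟩ := hz'
  have hzA := not_not.1 hzA
  have hzN := not_not.1 hzN
  have hzB : ICbar z < (C : EReal) * (e : EReal) := not_le.1 hzB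
  refine hz (hY.excessRisk_le hP hu hc hw hη hηθ _ (by positivity) (Or.inl ?_) h1')
  have hlt := (hzA.trans hzN).trans_lt hzB
  rw [← EReal.coe_mul, EReal.coe_lt_coe_iff] at hlt
  have hd : ∫ f, hellDiv P loss fstar (fun _ => ε) η f ∂(pointPost fhat n z)
      = hellDiv P loss fstar (fun _ => ε) η (fhat n z) :=
    integral_dirac' _ _ hhm.stronglyMeasurable
  have hav : (n : ℝ)⁻¹ * ∑ _i : Fin n, ε = ε := by
    simp only [Finset.sum_const, Finset.card_univ, Fintype.card_fin, nsmul_eq_mul]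
    rw [inv_mul_cancel_left₀ hn0.ne']
  rw [hd, hav] at hlt
  have hlog2 : 0 < Real.log 2 := Real.log_pos (by norm_num)
  have h3 : t / (η * n) ≤ C * (1 / (n * η)) := by
    rw [mul_one_div, mul_comm (n : ℝ) η]
    gcongr
    linarith
  nlinarith

lemma factorC₂_le {V κ : ℝ} (hu : 1 ≤ u) (hc : 0 < c) (hη : 0 < η) (hηθ : 2 * η < θ) (hκ : κ < 1 / 2)
    (hηκ : η ≤ κ * θ) (hV : θ ≤ V) :
    factorC₂ u c η θ ≤ u / c * ((V + 1) / (1 - 2 * κ)) := by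
  have hθ : 0 < θ := by linarith
  have h1 : 2 * η / θ ≤ 2 * κ := by
    rw [div_le_iff₀ hθ]; linarith
  unfold factorC₂
  have : 0 < 1 - 2 * κ := by linarith
  gcongr
  · linarith
  · linarith

lemma eventually_factorC₂_le {v : ℝ≥0 → ℝ≥0} (hv : IsEasinessFunction v) {η : ℕ → ℝ} {ε : ℕ → ℝ≥0}
    (hu : 1 ≤ u) (hc : 0 < c) (hη : ∀ n, 1 ≤ n → 0 < η n ∧ η n < v (ε n) / 2)
    (hκ : ∃ κ : ℝ, κ < 1 / 2 ∧ ∀ᶠ n in atTop, η n ≤ κ * v (ε n)) :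
    ∃ D : ℝ, 0 < D ∧ ∀ᶠ n in atTop, 0 < factorC₂ u c (η n) (v (ε n)) ∧
      factorC₂ u c (η n) (v (ε n)) ≤ D := by
  obtain ⟨κ, hκ, hev⟩ := hκ
  obtain ⟨V, hV⟩ := hv.bdd
  have : 0 < 1 - 2 * κ := by linarith
  refine ⟨u / c * ((V + 1) / (1 - 2 * κ)), by positivity, ?_⟩
  filter_upwards [hev, eventually_ge_atTop 1] with n hn hn1
  obtain ⟨h0, h1⟩ := hη n hn1
  refine ⟨factorC₂_pos hu hc h0 (by linarith), factorC₂_le hu hc h0 (by linarith) hκ hn ?_⟩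
  exact_mod_cast hV ⟨_, rfl⟩

lemma eventually_mul_le_one {a : ℕ → ℝ} {D : ℝ} (hD : 0 < D)
    (ha : ∀ᶠ n in atTop, 0 < a n ∧ a n ≤ D) {x : ℕ → EReal} (hx : Tendsto x atTop (𝓝 0)) :
    ∃ n₀ : ℕ, ∀ n, n₀ ≤ n → (a n : EReal) * x n ≤ 1 := by
  rw [← eventually_atTop]
  have hlt : (0 : EReal) < ((1 / D : ℝ) : EReal) := by
    have : 0 < 1 / D := by positivity
    exact_mod_cast this
  filter_upwards [ha, hx.eventually_lt_const hlt] with n hn hxn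
  calc (a n : EReal) * x n ≤ (a n : EReal) * ((1 / D : ℝ) : EReal) :=
        mul_le_mul_of_nonneg_left hxn.le (by exact_mod_cast hn.1.le)
    _ = ((a n * (1 / D) : ℝ) : EReal) := (EReal.coe_mul _ _).symm
    _ ≤ 1 := by
      have : a n * (1 / D) ≤ 1 := by rw [mul_one_div, div_le_one hD]; exact hn.2
      exact_mod_cast this

lemma EReal.tendsto_add_zero {x y : ℕ → EReal} (hx : Tendsto x atTop (𝓝 0))
    (hy : Tendsto y atTop (𝓝 0)) : Tendsto (fun n => x n + y n) atTop (𝓝 0) := by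
  have h := (EReal.continuousAt_add (p := ((0 : EReal), (0 : EReal))) (by simp) (by simp)).tendsto.comp
    (hx.prodMk_nhds hy)
  simpa [Function.comp_def] using h

lemma tendsto_zero_of_eventually_le {p : ℕ → ℝ≥0∞} {x : ℕ → ℝ} {B : ℝ} (hB : 0 < B)
    (hx : Tendsto x atTop (𝓝 0))
    (h : ∀ K : ℝ, 0 < K → ∀ᶠ n in atTop, p n ≤ ENNReal.ofReal ((1 / K + x n) / B)) :
    Tendsto p atTop (𝓝 0) := by
  rw [ENNReal.tendsto_nhds_zero]
  intro ζ hζ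
  rcases eq_or_ne ζ ∞ with rfl | hζt
  · exact Eventually.of_forall fun _ => le_top
  have hz : 0 < ζ.toReal := ENNReal.toReal_pos hζ.ne' hζt
  have hb : 0 < ζ.toReal * B / 2 := by positivity
  filter_upwards [h (2 / (ζ.toReal * B)) (by positivity), hx.eventually_lt_const hb] with n h1 h2
  refine h1.trans (ENNReal.ofReal_le_of_le_toReal ?_)
  rw [div_le_iff₀ hB, one_div_div]
  linarith

/-- The in-probability statement for randomized algorithms, for any threshold `R` that eventually
exceeds every multiple of `E[IC] + ε`. -/
lemma tendsto_post_excessRisk [IsProbabilityMeasure P]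
    (hP : IsLearningProblem P loss) (hu : 1 ≤ u) (hc : 0 < c)
    (hw : TauWitness P loss fstar (fun x => u * max 1 x) c)
    {v : ℝ≥0 → ℝ≥0} {η : ℕ → ℝ} {ε : ℕ → ℝ≥0}
    (hη : ∀ n, 1 ≤ n → 0 < η n ∧ η n < v (ε n) / 2) (hppc : VPPC P loss fstar v)
    [IsProbabilityMeasure prior] {post : (n : ℕ) → (Fin n → Z) → Measure F}
    (hpost : ∀ n, Measurable (post n))
    (hQ : ∀ n, 1 ≤ n → ∀ z, IsDistributionOn loss (post n z))
    (hIC : Tendsto (fun n => extExp (sampleLaw P n)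
      (infoComplexity loss fstar prior post (η n) n)) atTop (𝓝 0))
    (hCIC : Tendsto (fun n => (factorC₂ u c (η n) (v (ε n)) : EReal) * (extExp (sampleLaw P n)
      (infoComplexity loss fstar prior post (η n) n) + ((ε n : ℝ) : EReal))) atTop (𝓝 0))
    {R : ℕ → EReal}
    (hR : ∀ K : ℝ, 0 < K → ∀ᶠ n in atTop, ∀ e : ℝ, extExp (sampleLaw P n)
      (infoComplexity loss fstar prior post (η n) n) = e → 0 ≤ e + ε n →
        ((K * (e + ε n) : ℝ) : EReal) ≤ R n)
    {B : ℝ} (hB : 0 < B) :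
    Tendsto (fun n => sampleLaw P n {z | ENNReal.ofReal B < post n z {f |
      (factorC₂ u c (η n) (v (ε n)) : EReal) * R n < excessRisk P loss fstar f}}) atTop (𝓝 0) := by
  set e : ℕ → ℝ := fun n => (extExp (sampleLaw P n)
      (infoComplexity loss fstar prior post (η n) n)).toReal with he
  have hfin : ∀ᶠ n in atTop, extExp (sampleLaw P n)
      (infoComplexity loss fstar prior post (η n) n) = (e n : EReal) := by
    filter_upwards [hIC.eventually_lt_const (EReal.zero_lt_top),
      hIC.eventually_const_lt (EReal.bot_lt_zero)] with n h1 h2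
    exact (EReal.coe_toReal h1.ne h2.ne').symm
  have hx : Tendsto (fun n => factorC₂ u c (η n) (v (ε n)) * (e n + ε n)) atTop (𝓝 0) := by
    rw [← EReal.tendsto_coe]
    refine hCIC.congr' ?_
    filter_upwards [hfin] with n hn
    rw [hn, ← EReal.coe_add, ← EReal.coe_mul]
  refine tendsto_zero_of_eventually_le hB hx fun K hK => ?_
  filter_upwards [hfin, hR K hK, eventually_ge_atTop 1] with n hn hRn hn1
  obtain ⟨h0, h1⟩ := hη n hn1
  have hv0 : 0 < v (ε n) := by
    have : (0 : ℝ) < v (ε n) := by linarith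
    exact_mod_cast this
  obtain ⟨Y, hY⟩ := hppc.exists_isPseudoComparator hP hw hv0
  obtain ⟨e', he', hH⟩ := hY.exists_eq_coe_of_extExp_infoComplexity_le hP hw h0 (by linarith) hn1
    (prior := prior) (hpost n) (hQ n hn1) le_rfl (by rw [hn]; exact EReal.coe_ne_top _)
  obtain rfl : e' = e n := by rw [hn] at he'; exact_mod_cast he'.symm
  have hnn := hY.hellDiv_nonneg hP hw h0 (by linarith)
  have hC := factorC₂_pos (θ := v (ε n)) hu hc h0 (by linarith)
  refine hY.predictorLaw_excessRisk_le hP hu hc hw h0 (by linarith) (hpost n) (hQ n hn1) hH hK hB ?_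
  rw [EReal.coe_mul]
  exact mul_le_mul_of_nonneg_left (hRn _ hn ((integral_nonneg hnn).trans hH))
    (by exact_mod_cast hC.le)

end Setting

/-! ### The excess risk bound -/

theorem mainTheorem2 {Z F : Type*} [MeasurableSpace Z] [MeasurableSpace F]
    (P : Measure Z) [IsProbabilityMeasure P]
    (loss : F → Z → EReal) (hP : IsLearningProblem P loss) (fstar : F)
    (u c : ℝ) (hu : 1 ≤ u) (hc₀ : 0 < c) (hc₁ : c ≤ 1)
    (hwit : TauWitness P loss fstar (fun x => u * max 1 x) c)
    (v : ℝ≥0 → ℝ≥0) (hv : IsEasinessFunction v)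
    (η : ℕ → ℝ) (ε : ℕ → ℝ≥0)
    (hη : ∀ n, 1 ≤ n → 0 < η n ∧ η n < v (ε n) / 2)
    (hnη : Tendsto (fun n : ℕ => (n : ℝ) * η n) atTop atTop)
    (hε : Tendsto ε atTop (𝓝 0)) :
    -- Part 1: deterministic estimators
    (∀ (prior : Measure F) (_ : IsProbabilityMeasure prior)
        (fhat : (n : ℕ) → (Fin n → Z) → F)
        (_ : ∀ n, 1 ≤ n → Measurable (fhat n))
        (_ : ∀ n, 1 ≤ n → AEMeasurable
          (fun z => InformationTheory.klDiv (pointPost fhat n z) prior) (sampleLaw P n))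
        (_ : Tendsto (fun n => extExp (sampleLaw P n)
          (infoComplexity loss fstar prior (pointPost fhat) (η n) n)) atTop (𝓝 0)),
      -- under `v`-PPC
      (VPPC P loss fstar v →
        ∀ rhs : ℕ → ℝ → EReal,
          (∀ n δ, rhs n δ = ((factorC₂ u c (η n) (v (ε n)) * (1 / δ) : ℝ) : EReal) *
            (extExp (sampleLaw P n)
              (infoComplexity loss fstar prior (pointPost fhat) (η n) n) + ((ε n : ℝ) : EReal))) →
          (∀ n, 1 ≤ n → ∀ δ : ℝ, 0 < δ → rhs n δ ≤ 1 →
            1 - δ ≤ (sampleLaw P n).real {z | excessRisk P loss fstar (fhat n z) ≤ rhs n δ}) ∧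
          ((∃ κ : ℝ, κ < 1 / 2 ∧ ∀ᶠ n in atTop, η n ≤ κ * v (ε n)) →
            ∀ δ : ℝ, 0 < δ → ∃ n₀ : ℕ, ∀ n, n₀ ≤ n → rhs n δ ≤ 1)) ∧
      -- under `v`-central
      (VCentral P loss fstar v →
        ∀ (ICbar : (n : ℕ) → (Fin n → Z) → EReal)
          (_ : ∀ n, 1 ≤ n → AEMeasurable (ICbar n) (sampleLaw P n))
          (_ : ∀ n, 1 ≤ n → ∀ᵐ z ∂(sampleLaw P n),
            infoComplexity loss fstar prior (pointPost fhat) (η n) n z ≤ ICbar n z)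
          (_ : Tendsto (fun n => extExp (sampleLaw P n) (ICbar n)) atTop (𝓝 0))
          (C : ℕ → ℝ → ℝ)
          (_ : ∀ n, 1 ≤ n → ∀ δ : ℝ, 0 < δ → δ < 1 →
            2 * Real.log (2 / δ) < C n δ ∧
            (sampleLaw P n).real
              {z | (C n δ : EReal) * extExp (sampleLaw P n) (ICbar n) ≤ ICbar n z} ≤ δ / 2)
          (rhs : ℕ → ℝ → EReal)
          (_ : ∀ n δ, rhs n δ = ((factorC₂ u c (η n) (v (ε n)) * C n δ : ℝ) : EReal) *
            (extExp (sampleLaw P n) (ICbar n) + ((ε n : ℝ) : EReal)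
              + ((1 / (n * η n) : ℝ) : EReal))),
          (∀ n, 1 ≤ n → ∀ δ : ℝ, 0 < δ → δ < 1 → rhs n δ ≤ 1 →
            1 - δ ≤ (sampleLaw P n).real {z | excessRisk P loss fstar (fhat n z) ≤ rhs n δ}) ∧
          ((∃ κ : ℝ, κ < 1 / 2 ∧ ∀ᶠ n in atTop, η n ≤ κ * v (ε n)) →
            ∀ δ : ℝ, 0 < δ → δ < 1 → BddAbove (Set.range (fun n => C n δ)) →
              ∃ n₀ : ℕ, ∀ n, n₀ ≤ n → rhs n δ ≤ 1))) ∧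
    -- Part 2: general, possibly randomized, learning algorithms under `v`-PPC
    (∀ (prior : Measure F) (_ : IsProbabilityMeasure prior)
        (post : (n : ℕ) → Kernel (Fin n → Z) F)
        (_ : ∀ n, 1 ≤ n → ∀ z, IsDistributionOn loss (post n z))
        (_ : ∀ n, 1 ≤ n → AEMeasurable
          (fun z => InformationTheory.klDiv (post n z) prior) (sampleLaw P n))
        (_ : Tendsto (fun n => extExp (sampleLaw P n)
          (infoComplexity loss fstar prior (fun n z => post n z) (η n) n)) atTop (𝓝 0))
        (_ : Tendsto (fun n => (factorC₂ u c (η n) (v (ε n)) : EReal) *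
          (extExp (sampleLaw P n)
            (infoComplexity loss fstar prior (fun n z => post n z) (η n) n)
              + ((ε n : ℝ) : EReal))) atTop (𝓝 0))
        (_ : VPPC P loss fstar v)
        (a : ℕ → ℝ) (_ : Tendsto a atTop atTop)
        (ICbar : (n : ℕ) → (Fin n → Z) → EReal)
        (_ : ∀ n, 1 ≤ n → AEMeasurable (ICbar n) (sampleLaw P n))
        (_ : ∀ n, 1 ≤ n → ∀ᵐ z ∂(sampleLaw P n),
          (a n : EReal) * infoComplexity loss fstar prior (fun n z => post n z) (η n) n z
            ≤ ICbar n z),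
      (∀ B : ℝ, 0 < B → Tendsto (fun n => (sampleLaw P n)
        {z | ENNReal.ofReal B < post n z {f | (factorC₂ u c (η n) (v (ε n)) : EReal) *
          (extExp (sampleLaw P n) (ICbar n) + ((a n * ε n : ℝ) : EReal))
            < excessRisk P loss fstar f}}) atTop (𝓝 0)) ∧
      ((∀ M : ℝ, ∀ᶠ n in atTop, ((M * ε n : ℝ) : EReal) ≤ extExp (sampleLaw P n) (ICbar n)) →
        ∀ B : ℝ, 0 < B → Tendsto (fun n => (sampleLaw P n)
          {z | ENNReal.ofReal B < post n z {f | (factorC₂ u c (η n) (v (ε n)) : EReal) *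
            (extExp (sampleLaw P n) (ICbar n) + ((ε n : ℝ) : EReal))
              < excessRisk P loss fstar f}}) atTop (𝓝 0))) := by
  have hvpos : ∀ n, 1 ≤ n → 0 < v (ε n) := fun n hn => by
    have h := hη n hn
    have : (0 : ℝ) < v (ε n) := by linarith
    exact_mod_cast this
  have hεE : Tendsto (fun n => ((ε n : ℝ) : EReal)) atTop (𝓝 0) := by
    have h : Tendsto (fun n => (ε n : ℝ)) atTop (𝓝 0) := NNReal.tendsto_coe.2 hε
    exact EReal.tendsto_coe.2 h
  refine ⟨fun prior _ fhat hfhat _ hIC => ⟨fun hppc rhs hrhs => ⟨?_, ?_⟩,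
    fun hcen ICbar _ hle hICbar C hC rhs hrhs => ⟨?_, ?_⟩⟩, ?_⟩
  · intro n hn δ hδ h1
    obtain ⟨Y, hY⟩ := hppc.exists_isPseudoComparator hP hwit (hvpos n hn)
    rw [hrhs] at h1 ⊢
    exact hY.one_sub_le_measureReal_excessRisk hP hu hc₀ hwit (hη n hn).1 (by linarith [(hη n hn).2]) hn
      (hfhat n hn) hδ h1
  · intro hκ δ hδ
    obtain ⟨D, hD, hev⟩ := eventually_factorC₂_le hv hu hc₀ hη hκ
    simp only [hrhs]
    refine eventually_mul_le_one (D := D * (1 / δ)) (by positivity) ?_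
      (EReal.tendsto_add_zero hIC hεE)
    filter_upwards [hev] with n hn
    exact ⟨mul_pos hn.1 (by positivity), by gcongr; exact hn.2⟩
  · intro n hn δ hδ hδ1 h1
    have hY := hcen.isPseudoComparator hP hwit (hvpos n hn)
    rw [hrhs] at h1 ⊢
    exact hY.one_sub_le_measureReal_excessRisk_of_const hP hu hc₀ hwit (ε n).coe_nonneg (hη n hn).1
      (by linarith [(hη n hn).2]) hn (hfhat n hn) (hle n hn) hδ hδ1 (hC n hn δ hδ hδ1).1
      (hC n hn δ hδ hδ1).2 h1
  · intro hκ δ hδ hδ1 hbdd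
    obtain ⟨D, hD, hev⟩ := eventually_factorC₂_le hv hu hc₀ hη hκ
    obtain ⟨M, hM⟩ := hbdd
    have hCpos : ∀ n, 1 ≤ n → 0 < C n δ := fun n hn => by
      have h2 : 0 < Real.log (2 / δ) := Real.log_pos (by rw [lt_div_iff₀ hδ]; linarith)
      linarith [(hC n hn δ hδ hδ1).1]
    have hM0 : 0 < M := (hCpos 1 le_rfl).trans_le (hM ⟨1, rfl⟩)
    have hinv : Tendsto (fun n : ℕ => ((1 / (n * η n) : ℝ) : EReal)) atTop (𝓝 0) := by
      have h : Tendsto (fun n : ℕ => 1 / ((n : ℝ) * η n)) atTop (𝓝 0) := by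
        simpa only [one_div, Function.comp_def] using tendsto_inv_atTop_zero.comp hnη
      exact EReal.tendsto_coe.2 h
    simp only [hrhs]
    refine eventually_mul_le_one (D := D * M) (by positivity) ?_
      (EReal.tendsto_add_zero (EReal.tendsto_add_zero hICbar hεE) hinv)
    filter_upwards [hev, eventually_ge_atTop 1] with n hn hn1
    exact ⟨mul_pos hn.1 (hCpos n hn1),
      mul_le_mul hn.2 (hM ⟨n, rfl⟩) (hCpos n hn1).le hD.le⟩
  · intro prior _ post hQ _ hIC hCIC hppc a ha ICbar _ hle
    have hscale : ∀ n, 1 ≤ n → 0 < a n → ∀ e : ℝ, extExp (sampleLaw P n)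
        (infoComplexity loss fstar prior (fun n z => post n z) (η n) n) = e →
        ((a n * e : ℝ) : EReal) ≤ extExp (sampleLaw P n) (ICbar n) := by
      intro n hn han e he
      rw [EReal.coe_mul, ← he, ← extExp_const_mul han]
      exact extExp_mono_ae (hle n hn)
    refine ⟨fun B hB => ?_, fun hneg B hB => ?_⟩
    · refine tendsto_post_excessRisk hP hu hc₀ hwit hη hppc (fun n => (post n).measurable) hQ hIC hCIC
        (R := fun n => extExp (sampleLaw P n) (ICbar n) + ((a n * ε n : ℝ) : EReal)) ?_ hB
      intro K hK
      filter_upwards [ha.eventually_ge_atTop K, eventually_ge_atTop 1] with n hKn hn e he h0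
      have h1 := hscale n hn (hK.trans_le hKn) e he
      calc ((K * (e + ε n) : ℝ) : EReal) ≤ ((a n * e + a n * ε n : ℝ) : EReal) := by
            rw [EReal.coe_le_coe_iff]; nlinarith
        _ = ((a n * e : ℝ) : EReal) + ((a n * ε n : ℝ) : EReal) := EReal.coe_add _ _
        _ ≤ _ := by gcongr
    · refine tendsto_post_excessRisk hP hu hc₀ hwit hη hppc (fun n => (post n).measurable) hQ hIC hCIC
        (R := fun n => extExp (sampleLaw P n) (ICbar n) + ((ε n : ℝ) : EReal)) ?_ hB
      intro K hK
      filter_upwards [ha.eventually_ge_atTop (2 * K), hneg (2 * K), eventually_ge_atTop 1]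
        with n hKn hMn hn e he h0
      have h1 := hscale n hn (by linarith) e he
      have hε0 : (0 : ℝ) ≤ ε n := (ε n).coe_nonneg
      -- the larger of the two lower bounds on `E[ICbar]` dominates their average
      calc ((K * (e + ε n) : ℝ) : EReal) ≤ ((max (a n * e) (2 * K * ε n) : ℝ) : EReal) := by
            rw [EReal.coe_le_coe_iff]
            rcases le_total 0 e with h | h
            · nlinarith [le_max_left (a n * e) (2 * K * ε n),
                le_max_right (a n * e) (2 * K * ε n)]
            · nlinarith [le_max_right (a n * e) (2 * K * ε n), mul_nonneg hK.le hε0]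
        _ ≤ extExp (sampleLaw P n) (ICbar n) := by
            rcases max_cases (a n * e) (2 * K * ε n) with h | h <;> rw [h.1] <;> assumption
        _ ≤ extExp (sampleLaw P n) (ICbar n) + ((ε n : ℝ) : EReal) := by
            exact le_add_of_nonneg_right (by exact_mod_cast hε0)
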